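/- Let $n\ge 1$, let $m$ be Lebesgue measure on $\mathbb C^n=\mathbb R^{2n}$, and for $\lambda\in\mathbb R$ and $z=x+iy\in\mathbb C^n$ let $\pi_\lambda(z)$ be the unitary operator on $L^2(\mathbb R^n)$ given by $$(\pi_\lambda(z)\varphi)(\xi)=e^{i\lambda\left(x\cdot\xi+\frac12 x\cdot y\right)}\varphi(\xi+y).$$ For $g\in L^1(\mathbb C^n)$ let $W_\lambda(g)=\int_{\mathbb C^n}g(w)\,\pi_\lambda(w)\,dw$ be its Weyl transform, a bounded operator on $L^2(\mathbb R^n)$ (the integral is taken in the strong sense). For $g\in L^2(\mathbb C^n)$ let $W(g)$ be the bounded operator on $L^2(\mathbb R^n)$ determined by $\langle W(g)\varphi,\psi\rangle=\int_{\mathbb C^n}g(z)\langle\pi_1(z)\varphi,\psi\rangle\,dz$ for all $\varphi,\psi\in L^2(\mathbb R^n)$. Let $A\subseteq\mathbb C^n$ be a Lebesgue measurable set with $m(A)<\infty$. (1) Let $\lambda\in\mathbb R\setminus\{0\}$ and $g\in L^1(\mathbb C^n)$. If $g=0$ almost everywhere outside $A$ and $W_\lambda(g)$ has finite rank, then $g=0$.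 (2) Let $B$ be a finite-dimensional subspace of $L^2(\mathbb R^n)$. Let $E_A$ be the orthogonal projection $g\mapsto\chi_A g$ of $L^2(\mathbb C^n)$, and let $F_B$ be the orthogonal projection of $L^2(\mathbb C^n)$ onto the closed subspace of all $g$ for which the range of $W(g)$ is contained in $B$ (equivalently, $W(F_Bg)=P_BW(g)$ for all $g$, where $P_B$ is the orthogonal projection of $L^2(\mathbb R^n)$ onto $B$). Then $E_A\cap F_B=0$, where $E_A\cap F_B$ denotes the orthogonal projection onto the intersection of the ranges of $E_A$ and $F_B$. -/

import Mathlib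

open MeasureTheory

namespace HeisenbergWeyl

noncomputable section

/-! ### The underlying Hilbert spaces -/

/-- `L²(ℝⁿ)`. -/
abbrev L2R (n : ℕ) : Type := Lp ℂ 2 (volume : Measure (EuclideanSpace ℝ (Fin n)))

/-- `L²(ℂⁿ)`, with respect to Lebesgue measure `dx dy`, `z = x + i y`. -/
abbrev L2C (n : ℕ) : Type := Lp ℂ 2 (volume : Measure (Fin n → ℂ))

/-- `L¹(ℂⁿ)`. -/
abbrev L1C (n : ℕ) : Type := Lp ℂ 1 (volume : Measure (Fin n → ℂ))

/-- The real part `x` of `z = x + i y ∈ ℂⁿ`. -/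
def rePart {n : ℕ} (z : Fin n → ℂ) : EuclideanSpace ℝ (Fin n) := WithLp.toLp 2 fun j => (z j).re

/-- The imaginary part `y` of `z = x + i y ∈ ℂⁿ`. -/
def imPart {n : ℕ} (z : Fin n → ℂ) : EuclideanSpace ℝ (Fin n) := WithLp.toLp 2 fun j => (z j).im

theorem continuous_rePart {n : ℕ} : Continuous (rePart (n := n)) := by
  unfold rePart; fun_prop

theorem continuous_imPart {n : ℕ} : Continuous (imPart (n := n)) := by
  unfold imPart; fun_prop

/-! ### The Schrödinger representation -/

/-- The phase `exp (i λ (x · ξ + x · y / 2))`, where `z = x + i y`. -/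
def phase {n : ℕ} (lam : ℝ) (z : Fin n → ℂ) (ξ : EuclideanSpace ℝ (Fin n)) : ℂ :=
  Complex.exp (Complex.I *
    ((lam * (inner ℝ (rePart z) ξ + (1 / 2) * inner ℝ (rePart z) (imPart z)) : ℝ) : ℂ))

theorem norm_phase {n : ℕ} (lam : ℝ) (z : Fin n → ℂ) (ξ : EuclideanSpace ℝ (Fin n)) :
    ‖phase lam z ξ‖ = 1 := by
  rw [phase, mul_comm]; exact Complex.norm_exp_ofReal_mul_I _

theorem continuous_phase {n : ℕ} (lam : ℝ) (z : Fin n → ℂ) : Continuous (phase lam z) := by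
  unfold phase; fun_prop

theorem continuous_phase_left {n : ℕ} (lam : ℝ) (ξ : EuclideanSpace ℝ (Fin n)) :
    Continuous fun z => phase lam z ξ := by
  have h1 := continuous_rePart (n := n)
  have h2 := continuous_imPart (n := n)
  unfold phase; fun_prop

theorem memLp_phase_mul {n : ℕ} (lam : ℝ) (z : Fin n → ℂ) (φ : L2R n) :
    MemLp (fun ξ => phase lam z ξ * φ ξ) 2 volume := by
  refine (Lp.memLp φ).congr_norm
    ((continuous_phase lam z).aestronglyMeasurable.mul (Lp.aestronglyMeasurable φ)) ?_
  filter_upwards with ξ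
  rw [norm_mul, norm_phase, one_mul]

/-- Multiplication by the phase, an isometry of `L²(ℝⁿ)`. -/
def modulation {n : ℕ} (lam : ℝ) (z : Fin n → ℂ) : L2R n →ₗᵢ[ℂ] L2R n where
  toFun φ := (memLp_phase_mul lam z φ).toLp _
  map_add' φ ψ := by
    ext1
    filter_upwards [(memLp_phase_mul lam z (φ + ψ)).coeFn_toLp,
      (memLp_phase_mul lam z φ).coeFn_toLp, (memLp_phase_mul lam z ψ).coeFn_toLp,
      Lp.coeFn_add φ ψ, Lp.coeFn_add ((memLp_phase_mul lam z φ).toLp _)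
        ((memLp_phase_mul lam z ψ).toLp _)] with ξ h1 h2 h3 h4 h5
    rw [h1, h5, Pi.add_apply, h2, h3, h4, Pi.add_apply, mul_add]
  map_smul' c φ := by
    ext1
    filter_upwards [(memLp_phase_mul lam z (c • φ)).coeFn_toLp,
      (memLp_phase_mul lam z φ).coeFn_toLp,
      Lp.coeFn_smul c φ, Lp.coeFn_smul c ((memLp_phase_mul lam z φ).toLp _)] with ξ h1 h2 h4 h5
    rw [RingHom.id_apply, h1, h5, Pi.smul_apply, h2, h4, Pi.smul_apply, smul_eq_mul, smul_eq_mul]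
    ring
  norm_map' φ := by
    change ‖(memLp_phase_mul lam z φ).toLp _‖ = ‖φ‖
    refine le_antisymm (Lp.norm_le_norm_of_ae_le ?_) (Lp.norm_le_norm_of_ae_le ?_) <;>
    filter_upwards [(memLp_phase_mul lam z φ).coeFn_toLp] with ξ h <;>
    rw [h, norm_mul, norm_phase, one_mul]

theorem coeFn_modulation {n : ℕ} (lam : ℝ) (z : Fin n → ℂ) (φ : L2R n) :
    modulation lam z φ =ᵐ[volume] fun ξ => phase lam z ξ * φ ξ :=
  (memLp_phase_mul lam z φ).coeFn_toLp

/-- The translation `φ ↦ φ(· + y)`, an isometry of `L²(ℝⁿ)`. -/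
def translation {n : ℕ} (y : EuclideanSpace ℝ (Fin n)) : L2R n →ₗᵢ[ℂ] L2R n :=
  Lp.compMeasurePreservingₗᵢ ℂ (fun ξ => ξ + y) (measurePreserving_add_right volume y)

theorem coeFn_translation {n : ℕ} (y : EuclideanSpace ℝ (Fin n)) (φ : L2R n) :
    translation y φ =ᵐ[volume] fun ξ => φ (ξ + y) :=
  Lp.coeFn_compMeasurePreserving φ (measurePreserving_add_right volume y)

/-- The Schrödinger representation `π_λ(z) = π_λ(z, 0)` on `L²(ℝⁿ)`:
`(π_λ(z) φ)(ξ) = exp (i λ (x · ξ + x · y / 2)) φ(ξ + y)` for `z = x + i y`. -/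
def schrodinger {n : ℕ} (lam : ℝ) (z : Fin n → ℂ) : L2R n →ₗᵢ[ℂ] L2R n :=
  (modulation lam z).comp (translation (imPart z))

theorem coeFn_schrodinger {n : ℕ} (lam : ℝ) (z : Fin n → ℂ) (φ : L2R n) :
    schrodinger lam z φ =ᵐ[volume] fun ξ =>
      Complex.exp (Complex.I *
        ((lam * (inner ℝ (rePart z) ξ + (1 / 2) * inner ℝ (rePart z) (imPart z)) : ℝ) : ℂ)) *
        φ (ξ + imPart z) := by
  filter_upwards [coeFn_modulation lam z (translation (imPart z) φ),
    coeFn_translation (imPart z) φ] with ξ h1 h2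
  change modulation lam z (translation (imPart z) φ) ξ = _
  rw [h1, h2, phase]

theorem continuous_translation {n : ℕ} (φ : L2R n) :
    Continuous fun z : Fin n → ℂ => translation (imPart z) φ := by
  have hF : Continuous fun z : Fin n → ℂ =>
      (⟨fun ξ => ξ + imPart z, by fun_prop⟩ :
        C(EuclideanSpace ℝ (Fin n), EuclideanSpace ℝ (Fin n))) := by
    refine ContinuousMap.continuous_of_continuous_uncurry _ ?_
    have h2 := continuous_imPart (n := n)
    change Continuous fun p : (Fin n → ℂ) × EuclideanSpace ℝ (Fin n) => p.2 + imPart p.1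
    fun_prop
  exact (continuous_const (y := φ)).compMeasurePreservingLp hF
    (fun z => measurePreserving_add_right volume (imPart z)) (by norm_num)

theorem continuous_modulation {n : ℕ} (lam : ℝ) (φ : L2R n) :
    Continuous fun z : Fin n → ℂ => modulation lam z φ := by
  rw [continuous_iff_continuousAt]
  intro z₀
  rw [ContinuousAt, Lp.tendsto_Lp_iff_tendsto_eLpNorm']
  have key : ∀ z, eLpNorm (⇑(modulation lam z φ) - ⇑(modulation lam z₀ φ)) 2 volume
      = (∫⁻ ξ, ‖phase lam z ξ - phase lam z₀ ξ‖ₑ ^ (2 : ℝ) * ‖φ ξ‖ₑ ^ (2 : ℝ)) ^ (1 / (2 : ℝ)) := by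
    intro z
    rw [eLpNorm_eq_lintegral_rpow_enorm_toReal (by norm_num) (by norm_num)]
    simp only [ENNReal.toReal_ofNat]
    congr 1
    refine lintegral_congr_ae ?_
    filter_upwards [coeFn_modulation lam z φ, coeFn_modulation lam z₀ φ] with ξ h1 h2
    rw [Pi.sub_apply, h1, h2, ← sub_mul, enorm_mul, ENNReal.mul_rpow_of_nonneg _ _ (by norm_num)]
  simp_rw [key]
  have h0 : (0 : ENNReal) = (∫⁻ ξ : EuclideanSpace ℝ (Fin n), 0) ^ (1 / (2 : ℝ)) := by simp
  rw [h0]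
  refine (ENNReal.continuous_rpow_const.tendsto _).comp ?_
  refine tendsto_lintegral_filter_of_dominated_convergence
    (fun ξ => (2 : ENNReal) ^ (2 : ℝ) * ‖φ ξ‖ₑ ^ (2 : ℝ)) ?_ ?_ ?_ ?_
  · refine Filter.Eventually.of_forall fun z => ?_
    have h1 := (continuous_phase lam z).measurable
    have h2 := (continuous_phase lam z₀).measurable
    have h3 := (Lp.stronglyMeasurable φ).measurable
    fun_prop
  · refine Filter.Eventually.of_forall fun z => Filter.Eventually.of_forall fun ξ => ?_
    gcongr
    refine (enorm_sub_le).trans ?_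
    rw [← ofReal_norm, ← ofReal_norm, norm_phase, norm_phase]
    norm_num
  · have h := (Lp.memLp φ).2
    rw [eLpNorm_lt_top_iff_lintegral_rpow_enorm_lt_top (by norm_num) (by norm_num)] at h
    simp only [ENNReal.toReal_ofNat] at h
    rw [lintegral_const_mul' _ _ (by norm_num)]
    exact (ENNReal.mul_lt_top (by norm_num) h).ne
  · refine Filter.Eventually.of_forall fun ξ => ?_
    have hc : Continuous fun z => ‖phase lam z ξ - phase lam z₀ ξ‖ₑ ^ (2 : ℝ) :=
      ENNReal.continuous_rpow_const.comp
        (((continuous_phase_left lam ξ).sub continuous_const).enorm)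
    have ht := hc.tendsto z₀
    have hz : ‖phase lam z₀ ξ - phase lam z₀ ξ‖ₑ ^ (2 : ℝ) = 0 := by simp
    rw [hz] at ht
    have := ENNReal.Tendsto.mul_const (b := ‖φ ξ‖ₑ ^ (2 : ℝ)) ht (Or.inr (by simp))
    simpa using this

/-- Strong continuity of the Schrödinger representation. -/
theorem continuous_schrodinger {n : ℕ} (lam : ℝ) (φ : L2R n) :
    Continuous fun z : Fin n → ℂ => schrodinger lam z φ := by
  rw [continuous_iff_continuousAt]
  intro z₀
  rw [ContinuousAt, tendsto_iff_norm_sub_tendsto_zero]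
  have h1 : Filter.Tendsto (fun z => ‖translation (imPart z) φ - translation (imPart z₀) φ‖
      + ‖modulation lam z (translation (imPart z₀) φ)
        - modulation lam z₀ (translation (imPart z₀) φ)‖) (nhds z₀) (nhds (0 + 0)) :=
    (tendsto_iff_norm_sub_tendsto_zero.1 ((continuous_translation φ).tendsto z₀)).add
      (tendsto_iff_norm_sub_tendsto_zero.1
        ((continuous_modulation lam (translation (imPart z₀) φ)).tendsto z₀))
  rw [add_zero] at h1
  refine squeeze_zero (fun _ => norm_nonneg _) (fun z => ?_) h1
  have : schrodinger lam z φ - schrodinger lam z₀ φ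
      = modulation lam z (translation (imPart z) φ - translation (imPart z₀) φ)
        + (modulation lam z (translation (imPart z₀) φ)
          - modulation lam z₀ (translation (imPart z₀) φ)) := by
    rw [map_sub]; simp [schrodinger]
  rw [this]
  refine (norm_add_le _ _).trans ?_
  rw [LinearIsometry.norm_map]

/-! ### The Weyl transform on `L¹(ℂⁿ)` -/

theorem integrable_smul_schrodinger {n : ℕ} (lam : ℝ) (g : L1C n) (φ : L2R n) :
    Integrable fun w : Fin n → ℂ => g w • schrodinger lam w φ := by
  have hg : Integrable g := memLp_one_iff_integrable.1 (Lp.memLp g)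
  refine (hg.norm.mul_const ‖φ‖).mono'
    (hg.1.smul (continuous_schrodinger lam φ).aestronglyMeasurable) ?_
  filter_upwards with w
  rw [norm_smul, LinearIsometry.norm_map]

/-- The Weyl transform `W_λ(g) = ∫ g(w) π_λ(w) dw` of `g ∈ L¹(ℂⁿ)`, a bounded operator on
`L²(ℝⁿ)`; the operator-valued integral is taken in the strong sense (for every `φ`,
`w ↦ g(w) π_λ(w) φ` is Bochner integrable in `L²(ℝⁿ)`). -/
def weylTransform {n : ℕ} (lam : ℝ) (g : L1C n) : L2R n →L[ℂ] L2R n :=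
  LinearMap.mkContinuous
    { toFun := fun φ => ∫ w : Fin n → ℂ, g w • schrodinger lam w φ
      map_add' := fun φ ψ => by
        rw [← integral_add (integrable_smul_schrodinger lam g φ)
          (integrable_smul_schrodinger lam g ψ)]
        simp only [map_add, smul_add]
      map_smul' := fun c φ => by
        rw [RingHom.id_apply, ← integral_smul]
        simp only [map_smul, smul_comm c] }
    (∫ w : Fin n → ℂ, ‖g w‖)
    (fun φ => by
      refine (norm_integral_le_integral_norm _).trans (le_of_eq ?_)
      rw [← integral_mul_const]
      simp only [norm_smul, LinearIsometry.norm_map])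

theorem weylTransform_apply {n : ℕ} (lam : ℝ) (g : L1C n) (φ : L2R n) :
    weylTransform lam g φ = ∫ w : Fin n → ℂ, g w • schrodinger lam w φ := rfl

/-! ### Square integrability of the matrix coefficients of `π = π_1` -/

/-- Plancherel for integrable and square integrable functions on `ℝⁿ`. -/
theorem lintegral_fourier_sq {n : ℕ} {h : EuclideanSpace ℝ (Fin n) → ℂ} (hh : Integrable h)
    (htop : ∫⁻ x, ‖h x‖ₑ ^ (2 : ℝ) ≠ ⊤) :
    ∫⁻ x, ‖FourierTransform.fourier h x‖ₑ ^ (2 : ℝ) = ∫⁻ x, ‖h x‖ₑ ^ (2 : ℝ) := by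
  have h2 : MemLp h 2 volume := by
    refine ⟨hh.1, ?_⟩
    rw [eLpNorm_lt_top_iff_lintegral_rpow_enorm_lt_top (by norm_num) (by norm_num)]
    simpa only [ENNReal.toReal_ofNat] using lt_top_iff_ne_top.2 htop
  set H : L2R n := h2.toLp h with hH
  set F : L2R n := FourierTransform.fourier H with hF
  have hcont : Continuous (FourierTransform.fourier h) :=
    VectorFourier.fourierIntegral_continuous Real.continuous_fourierChar
      (by exact continuous_inner) hh
  have hae : FourierTransform.fourier h =ᵐ[volume] F := by
    refine ae_eq_of_integral_contDiff_smul_eq hcont.locallyIntegrable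
      ((Lp.memLp F).locallyIntegrable (by norm_num)) ?_
    intro g g_smooth g_cpt
    have hg₁ : HasCompactSupport (Complex.ofRealCLM ∘ g) := g_cpt.comp_left rfl
    have hg₂ : ContDiff ℝ (⊤ : ℕ∞) (Complex.ofRealCLM ∘ g) := by fun_prop
    set s : SchwartzMap (EuclideanSpace ℝ (Fin n)) ℂ := hg₁.toSchwartzMap hg₂ with hs
    have e1 : ∫ x, g x • F x = ∫ x, s x • F x := by
      simp [hs]
    have e2 : ∫ x, g x • FourierTransform.fourier h x
        = ∫ x, s x • FourierTransform.fourier h x := by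
      simp [hs]
    have e3 : ∫ x, s x • F x
        = ∫ x, (FourierTransform.fourier s : SchwartzMap _ ℂ) x • H x := by
      rw [← Lp.toTemperedDistribution_apply F s, ← Lp.toTemperedDistribution_apply H,
        hF, ← Lp.fourier_toTemperedDistribution_eq H]
      rfl
    have e4 : ∫ x, (FourierTransform.fourier s : SchwartzMap _ ℂ) x • H x
        = ∫ x, (FourierTransform.fourier s : SchwartzMap _ ℂ) x • h x := by
      refine integral_congr_ae ?_
      filter_upwards [h2.coeFn_toLp] with x hx
      rw [hH, hx]
    have e5 : ∫ x, (FourierTransform.fourier s : SchwartzMap _ ℂ) x • h x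
        = ∫ x, s x • FourierTransform.fourier h x := by
      have := VectorFourier.integral_fourierIntegral_smul_eq_flip
        (L := innerₗ (EuclideanSpace ℝ (Fin n))) (μ := volume) (ν := volume)
        Real.continuous_fourierChar (by exact continuous_inner)
        (f := s) (g := h) s.integrable hh
      rw [flip_innerₗ] at this
      rw [SchwartzMap.fourier_coe]
      exact this
    rw [e1, e2, e3, e4, e5]
  have hn : eLpNorm (FourierTransform.fourier h) 2 volume = eLpNorm h 2 volume := by
    rw [eLpNorm_congr_ae hae, ← eLpNorm_congr_ae h2.coeFn_toLp, ← Lp.enorm_def, ← Lp.enorm_def,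
      ← ofReal_norm, ← ofReal_norm, hF, Lp.norm_fourier_eq]
  have hn2 := congrArg (fun t : ENNReal => t ^ (2 : ℝ)) hn
  beta_reduce at hn2
  rw [eLpNorm_eq_lintegral_rpow_enorm_toReal (by norm_num) (by norm_num),
    eLpNorm_eq_lintegral_rpow_enorm_toReal (by norm_num) (by norm_num),
    ← ENNReal.rpow_mul, ← ENNReal.rpow_mul] at hn2
  simpa using hn2

/-- `(x, y) ↦ x + i y`. -/
def ofReIm {n : ℕ} (p : EuclideanSpace ℝ (Fin n) × EuclideanSpace ℝ (Fin n)) : Fin n → ℂ :=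
  fun j => ⟨p.1 j, p.2 j⟩

theorem rePart_ofReIm {n : ℕ} (p : EuclideanSpace ℝ (Fin n) × EuclideanSpace ℝ (Fin n)) :
    rePart (ofReIm p) = p.1 := rfl

theorem imPart_ofReIm {n : ℕ} (p : EuclideanSpace ℝ (Fin n) × EuclideanSpace ℝ (Fin n)) :
    imPart (ofReIm p) = p.2 := rfl

theorem measurePreserving_ofReIm {n : ℕ} :
    MeasurePreserving (ofReIm (n := n)) volume volume := by
  have h1 := (PiLp.volume_preserving_ofLp (Fin n)).prod (PiLp.volume_preserving_ofLp (Fin n))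
  have h2 := (volume_measurePreserving_arrowProdEquivProdArrow ℝ ℝ (Fin n)).symm
  have h3 := volume_preserving_pi
    (fun _ : Fin n => Complex.volume_preserving_equiv_real_prod.symm)
  exact (h3.comp h2).comp h1

theorem lintegral_comp_smul_inv {n : ℕ} (G : EuclideanSpace ℝ (Fin n) → ENNReal)
    (hG : Measurable G) {r : ℝ} (hr : 0 < r) :
    ∫⁻ x, G (r⁻¹ • x) = ENNReal.ofReal (r ^ n) * ∫⁻ x, G x := by
  have h := Measure.map_addHaar_smul (volume : Measure (EuclideanSpace ℝ (Fin n)))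
    (inv_ne_zero hr.ne')
  rw [← lintegral_map hG (measurable_const_smul (r⁻¹ : ℝ)), h, lintegral_smul_measure]
  congr 2
  rw [finrank_euclideanSpace_fin, inv_pow, inv_inv, abs_of_pos (pow_pos hr n)]

/-- The function `z ↦ ⟨ψ, π(z) φ⟩` (paired so as to be linear in `ψ`). -/
def matrixCoeff {n : ℕ} (φ ψ : L2R n) (z : Fin n → ℂ) : ℂ := inner ℂ (schrodinger 1 z φ) ψ

theorem continuous_matrixCoeff {n : ℕ} (φ ψ : L2R n) : Continuous (matrixCoeff φ ψ) :=
  (continuous_schrodinger 1 φ).inner continuous_const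

theorem integrable_translate_mul {n : ℕ} (φ ψ : L2R n) (y : EuclideanSpace ℝ (Fin n)) :
    Integrable fun ξ => (starRingEnd ℂ) (φ (ξ + y)) * ψ ξ := by
  refine (L2.integrable_inner (𝕜 := ℂ) (translation y φ) ψ).congr ?_
  filter_upwards [coeFn_translation y φ] with ξ h
  rw [h, RCLike.inner_apply, mul_comm]

theorem norm_matrixCoeff {n : ℕ} (φ ψ : L2R n)
    (p : EuclideanSpace ℝ (Fin n) × EuclideanSpace ℝ (Fin n)) :
    ‖matrixCoeff φ ψ (ofReIm p)‖ₑ = ‖FourierTransform.fourier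
      (fun ξ => (starRingEnd ℂ) (φ (ξ + p.2)) * ψ ξ) ((2 * Real.pi)⁻¹ • p.1)‖ₑ := by
  have h1 : matrixCoeff φ ψ (ofReIm p)
      = (starRingEnd ℂ) (Complex.exp (Complex.I * (((1 / 2) * inner ℝ p.1 p.2 : ℝ) : ℂ))) *
        FourierTransform.fourier (fun ξ => (starRingEnd ℂ) (φ (ξ + p.2)) * ψ ξ)
          ((2 * Real.pi)⁻¹ • p.1) := by
    rw [matrixCoeff, L2.inner_def, Real.fourier_eq', ← integral_const_mul]
    refine integral_congr_ae ?_
    filter_upwards [coeFn_schrodinger 1 (ofReIm p) φ] with ξ h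
    rw [h, RCLike.inner_apply, rePart_ofReIm, imPart_ofReIm, map_mul, ← Complex.exp_conj,
      ← Complex.exp_conj, smul_eq_mul]
    have e : (starRingEnd ℂ) (Complex.I * (((1 : ℝ) * (inner ℝ p.1 ξ
          + (1 / 2) * inner ℝ p.1 p.2) : ℝ) : ℂ))
        = (starRingEnd ℂ) (Complex.I * (((1 / 2) * inner ℝ p.1 p.2 : ℝ) : ℂ))
          + ((-2 * Real.pi * inner ℝ ξ ((2 * Real.pi)⁻¹ • p.1) : ℝ) : ℂ) * Complex.I := by
      have hpi : (Real.pi : ℂ) ≠ 0 := by exact_mod_cast Real.pi_ne_zero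
      rw [inner_smul_right, real_inner_comm p.1 ξ, map_mul, map_mul, Complex.conj_I,
        Complex.conj_ofReal, Complex.conj_ofReal]
      push_cast
      field_simp
      ring
    rw [e, Complex.exp_add]
    ring
  have h2 : ‖(starRingEnd ℂ) (Complex.exp (Complex.I * (((1 / 2) * inner ℝ p.1 p.2 : ℝ) : ℂ)))‖ₑ
      = 1 := by
    rw [← ofReal_norm, RCLike.norm_conj, mul_comm Complex.I, Complex.norm_exp_ofReal_mul_I]
    simp
  rw [h1, enorm_mul, h2, one_mul]

theorem lintegral_sq_L2R {n : ℕ} (φ : L2R n) :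
    ∫⁻ ξ, ‖φ ξ‖ₑ ^ (2 : ℝ) = ‖φ‖ₑ ^ (2 : ℝ) := by
  rw [Lp.enorm_def, eLpNorm_eq_lintegral_rpow_enorm_toReal (by norm_num) (by norm_num),
    ← ENNReal.rpow_mul]
  simp

theorem lintegral_matrixCoeff_sq {n : ℕ} (φ ψ : L2R n) :
    ∫⁻ z, ‖matrixCoeff φ ψ z‖ₑ ^ (2 : ℝ)
      = ENNReal.ofReal ((2 * Real.pi) ^ n) * (‖φ‖ₑ ^ (2 : ℝ) * ‖ψ‖ₑ ^ (2 : ℝ)) := by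
  have hm : Measurable fun z => ‖matrixCoeff φ ψ z‖ₑ ^ (2 : ℝ) :=
    (continuous_matrixCoeff φ ψ).measurable.enorm.pow_const _
  have mφ := (Lp.stronglyMeasurable φ).measurable
  have mψ := (Lp.stronglyMeasurable ψ).measurable
  have total : ∫⁻ y, ∫⁻ ξ, ‖φ (ξ + y)‖ₑ ^ (2 : ℝ) * ‖ψ ξ‖ₑ ^ (2 : ℝ)
      = ‖φ‖ₑ ^ (2 : ℝ) * ‖ψ‖ₑ ^ (2 : ℝ) := by
    rw [lintegral_lintegral_swap (by fun_prop)]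
    have : ∀ ξ : EuclideanSpace ℝ (Fin n),
        ∫⁻ y, ‖φ (ξ + y)‖ₑ ^ (2 : ℝ) * ‖ψ ξ‖ₑ ^ (2 : ℝ) = ‖φ‖ₑ ^ (2 : ℝ) * ‖ψ ξ‖ₑ ^ (2 : ℝ) := by
      intro ξ
      rw [lintegral_mul_const _ (by fun_prop),
        lintegral_add_left_eq_self (fun y => ‖φ y‖ₑ ^ (2 : ℝ)) ξ, lintegral_sq_L2R]
    simp_rw [this]
    rw [lintegral_const_mul _ (by fun_prop), lintegral_sq_L2R]
  have hfin : ∀ᵐ y : EuclideanSpace ℝ (Fin n),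
      ∫⁻ ξ, ‖φ (ξ + y)‖ₑ ^ (2 : ℝ) * ‖ψ ξ‖ₑ ^ (2 : ℝ) < ⊤ := by
    refine ae_lt_top ?_ ?_
    · have : Measurable fun p : EuclideanSpace ℝ (Fin n) × EuclideanSpace ℝ (Fin n) =>
          ‖φ (p.2 + p.1)‖ₑ ^ (2 : ℝ) * ‖ψ p.2‖ₑ ^ (2 : ℝ) := by fun_prop
      exact this.lintegral_prod_right'
    · rw [total]
      refine (ENNReal.mul_lt_top ?_ ?_).ne <;>
      exact ENNReal.rpow_lt_top_of_nonneg (by norm_num) enorm_ne_top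
  rw [← measurePreserving_ofReIm.lintegral_comp hm, Measure.volume_eq_prod,
    lintegral_prod_symm' (fun p => ‖matrixCoeff φ ψ (ofReIm p)‖ₑ ^ (2 : ℝ))
      (hm.comp measurePreserving_ofReIm.measurable), ← total,
    ← lintegral_const_mul' _ _ ENNReal.ofReal_ne_top]
  refine lintegral_congr_ae ?_
  filter_upwards [hfin] with y hy
  have hint := integrable_translate_mul φ ψ y
  have hcont : Continuous (FourierTransform.fourier
      (fun ξ => (starRingEnd ℂ) (φ (ξ + y)) * ψ ξ)) :=
    VectorFourier.fourierIntegral_continuous Real.continuous_fourierChar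
      (by exact continuous_inner) hint
  have hsq : ∫⁻ ξ, ‖(starRingEnd ℂ) (φ (ξ + y)) * ψ ξ‖ₑ ^ (2 : ℝ)
      = ∫⁻ ξ, ‖φ (ξ + y)‖ₑ ^ (2 : ℝ) * ‖ψ ξ‖ₑ ^ (2 : ℝ) := by
    refine lintegral_congr fun ξ => ?_
    rw [enorm_mul, ENNReal.mul_rpow_of_nonneg _ _ (by norm_num), ← ofReal_norm, RCLike.norm_conj,
      ofReal_norm]
  simp_rw [norm_matrixCoeff]
  rw [lintegral_comp_smul_inv (fun x => ‖FourierTransform.fourier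
      (fun ξ => (starRingEnd ℂ) (φ (ξ + y)) * ψ ξ) x‖ₑ ^ (2 : ℝ))
      (hcont.measurable.enorm.pow_const _) (by positivity),
    lintegral_fourier_sq hint (by rw [hsq]; exact hy.ne), hsq]

theorem memLp_matrixCoeff {n : ℕ} (φ ψ : L2R n) : MemLp (matrixCoeff φ ψ) 2 volume := by
  refine ⟨(continuous_matrixCoeff φ ψ).aestronglyMeasurable, ?_⟩
  rw [eLpNorm_lt_top_iff_lintegral_rpow_enorm_lt_top (by norm_num) (by norm_num)]
  simp only [ENNReal.toReal_ofNat]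
  rw [lintegral_matrixCoeff_sq φ ψ]
  refine ENNReal.mul_lt_top ENNReal.ofReal_lt_top (ENNReal.mul_lt_top ?_ ?_) <;>
  exact ENNReal.rpow_lt_top_of_nonneg (by norm_num) enorm_ne_top

theorem norm_toLp_matrixCoeff {n : ℕ} (φ ψ : L2R n) :
    ‖(memLp_matrixCoeff φ ψ).toLp _‖ = Real.sqrt ((2 * Real.pi) ^ n) * ‖φ‖ * ‖ψ‖ := by
  rw [Lp.norm_toLp, eLpNorm_eq_lintegral_rpow_enorm_toReal (by norm_num) (by norm_num)]
  simp only [ENNReal.toReal_ofNat]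
  rw [lintegral_matrixCoeff_sq, ← ofReal_norm, ← ofReal_norm,
    ENNReal.ofReal_rpow_of_nonneg (norm_nonneg _) (by norm_num),
    ENNReal.ofReal_rpow_of_nonneg (norm_nonneg _) (by norm_num), ← ENNReal.ofReal_mul (by positivity),
    ← ENNReal.ofReal_mul (by positivity),
    ENNReal.ofReal_rpow_of_nonneg (by positivity) (by norm_num), ← Real.sqrt_eq_rpow,
    ENNReal.toReal_ofReal (Real.sqrt_nonneg _),
    Real.sqrt_mul (by positivity), Real.sqrt_mul (by positivity), Real.rpow_two, Real.rpow_two,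
    Real.sqrt_sq (norm_nonneg _), Real.sqrt_sq (norm_nonneg _), mul_assoc]

/-! ### The Weyl transform on `L²(ℂⁿ)` -/

/-- The bounded linear map `ψ ↦ ⟨ψ, π(·) φ⟩` from `L²(ℝⁿ)` to `L²(ℂⁿ)`. -/
def matrixCoeffCLM {n : ℕ} (φ : L2R n) : L2R n →L[ℂ] L2C n :=
  LinearMap.mkContinuous
    { toFun := fun ψ => (memLp_matrixCoeff φ ψ).toLp _
      map_add' := fun ψ₁ ψ₂ => by
        rw [← MemLp.toLp_add]
        congr 1
        funext z
        exact inner_add_right _ _ _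
      map_smul' := fun c ψ => by
        rw [RingHom.id_apply, ← MemLp.toLp_const_smul]
        congr 1
        funext z
        exact inner_smul_right _ _ _ }
    (Real.sqrt ((2 * Real.pi) ^ n) * ‖φ‖)
    (fun ψ => (norm_toLp_matrixCoeff φ ψ).le)

theorem coeFn_matrixCoeffCLM {n : ℕ} (φ ψ : L2R n) :
    matrixCoeffCLM φ ψ =ᵐ[volume] fun z => inner ℂ (schrodinger 1 z φ) ψ :=
  (memLp_matrixCoeff φ ψ).coeFn_toLp

theorem norm_matrixCoeffCLM_le {n : ℕ} (φ : L2R n) :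
    ‖matrixCoeffCLM φ‖ ≤ Real.sqrt ((2 * Real.pi) ^ n) * ‖φ‖ :=
  LinearMap.mkContinuous_norm_le _ (by positivity) _

theorem matrixCoeffCLM_add {n : ℕ} (φ₁ φ₂ : L2R n) :
    matrixCoeffCLM (φ₁ + φ₂) = matrixCoeffCLM φ₁ + matrixCoeffCLM φ₂ := by
  ext1 ψ
  ext1
  filter_upwards [coeFn_matrixCoeffCLM (φ₁ + φ₂) ψ, coeFn_matrixCoeffCLM φ₁ ψ,
    coeFn_matrixCoeffCLM φ₂ ψ, Lp.coeFn_add (matrixCoeffCLM φ₁ ψ) (matrixCoeffCLM φ₂ ψ)]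
    with z h1 h2 h3 h4
  rw [_root_.add_apply, h1, h4, Pi.add_apply, h2, h3, map_add, inner_add_left]

theorem matrixCoeffCLM_smul {n : ℕ} (c : ℂ) (φ : L2R n) :
    matrixCoeffCLM (c • φ) = (starRingEnd ℂ) c • matrixCoeffCLM φ := by
  ext1 ψ
  ext1
  filter_upwards [coeFn_matrixCoeffCLM (c • φ) ψ, coeFn_matrixCoeffCLM φ ψ,
    Lp.coeFn_smul ((starRingEnd ℂ) c) (matrixCoeffCLM φ ψ)] with z h1 h2 h4
  rw [_root_.smul_apply, h1, h4, Pi.smul_apply, h2, map_smul, inner_smul_left,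
    smul_eq_mul]

/-- The Weyl transform `W(g) = W_1(g) = ∫ g(z) π(z) dz` of `g ∈ L²(ℂⁿ)`, a bounded operator on
`L²(ℝⁿ)`; the operator-valued integral is taken in the weak sense, that is,
`⟨ψ, W(g) φ⟩ = ∫ g(z) ⟨ψ, π(z) φ⟩ dz` for all `φ, ψ`, see `inner_weylTransformL2`. -/
def weylTransformL2 {n : ℕ} : L2C n →L[ℂ] L2R n →L[ℂ] L2R n :=
  LinearMap.mkContinuous₂
    (LinearMap.mk₂ ℂ (fun (g : L2C n) (φ : L2R n) => ContinuousLinearMap.adjoint (matrixCoeffCLM φ) g)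
      (fun g₁ g₂ φ => map_add _ _ _)
      (fun c g φ => map_smul _ _ _)
      (fun g φ₁ φ₂ => by rw [matrixCoeffCLM_add, map_add, _root_.add_apply])
      (fun c g φ => by
        rw [matrixCoeffCLM_smul, map_smulₛₗ, Complex.conj_conj, _root_.smul_apply]))
    (Real.sqrt ((2 * Real.pi) ^ n))
    (fun g φ => by
      rw [LinearMap.mk₂_apply]
      refine (ContinuousLinearMap.le_opNorm _ _).trans ?_
      rw [LinearIsometryEquiv.norm_map]
      refine (mul_le_mul_of_nonneg_right (norm_matrixCoeffCLM_le φ) (norm_nonneg g)).trans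
        (le_of_eq ?_)
      ring)

theorem weylTransformL2_apply {n : ℕ} (g : L2C n) (φ : L2R n) :
    weylTransformL2 g φ = ContinuousLinearMap.adjoint (matrixCoeffCLM φ) g := rfl

theorem inner_weylTransformL2 {n : ℕ} (g : L2C n) (φ ψ : L2R n) :
    Integrable (fun z : Fin n → ℂ => g z * inner ℂ ψ (schrodinger 1 z φ)) ∧
    inner ℂ ψ (weylTransformL2 g φ)
      = ∫ z : Fin n → ℂ, g z * inner ℂ ψ (schrodinger 1 z φ) := by
  have hae : (fun z => inner ℂ (matrixCoeffCLM φ ψ z) (g z)) =ᵐ[volume]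
      fun z : Fin n → ℂ => g z * inner ℂ ψ (schrodinger 1 z φ) := by
    filter_upwards [coeFn_matrixCoeffCLM φ ψ] with z h
    rw [h, RCLike.inner_apply, inner_conj_symm]
  refine ⟨(L2.integrable_inner (𝕜 := ℂ) (matrixCoeffCLM φ ψ) g).congr hae, ?_⟩
  rw [← integral_congr_ae hae, ← L2.inner_def, weylTransformL2_apply,
    ContinuousLinearMap.adjoint_inner_right]

/-! ### The projections `E_A`, `F_B` and the intersection of two projections -/

theorem memLp_indicator {n : ℕ} {A : Set (Fin n → ℂ)} (hA : NullMeasurableSet A volume)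
    (g : L2C n) : MemLp (A.indicator g) 2 volume :=
  (Lp.memLp g).mono ((Lp.aestronglyMeasurable g).indicator₀ hA)
    (Filter.Eventually.of_forall fun z => norm_indicator_le_norm_self _ z)

/-- The orthogonal projection `E_A g = χ_A g` of `L²(ℂⁿ)`, `A` Lebesgue measurable. -/
def projE {n : ℕ} (A : Set (Fin n → ℂ)) (hA : NullMeasurableSet A volume) : L2C n →L[ℂ] L2C n :=
  LinearMap.mkContinuous
    { toFun := fun g => (memLp_indicator hA g).toLp _
      map_add' := fun g₁ g₂ => by
        rw [← MemLp.toLp_add, MemLp.toLp_eq_toLp_iff]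
        filter_upwards [Lp.coeFn_add g₁ g₂] with z h
        have h' := h.trans (Pi.add_apply (⇑g₁) (⇑g₂) z)
        by_cases hz : z ∈ A
        · rw [Set.indicator_of_mem hz, h', Pi.add_apply, Set.indicator_of_mem hz,
            Set.indicator_of_mem hz]
        · rw [Set.indicator_of_notMem hz, Pi.add_apply, Set.indicator_of_notMem hz,
            Set.indicator_of_notMem hz, add_zero]
      map_smul' := fun c g => by
        rw [RingHom.id_apply, ← MemLp.toLp_const_smul, MemLp.toLp_eq_toLp_iff]
        filter_upwards [Lp.coeFn_smul c g] with z h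
        by_cases hz : z ∈ A
        · rw [Set.indicator_of_mem hz, h, Pi.smul_apply, Pi.smul_apply, Set.indicator_of_mem hz]
        · rw [Set.indicator_of_notMem hz, Pi.smul_apply, Set.indicator_of_notMem hz, smul_zero] }
    1
    (fun g => by
      rw [one_mul]
      refine Lp.norm_le_norm_of_ae_le ?_
      filter_upwards [(memLp_indicator hA g).coeFn_toLp] with z h
      change ‖(memLp_indicator hA g).toLp _ z‖ ≤ _
      rw [h]
      exact norm_indicator_le_norm_self _ z)

theorem coeFn_projE {n : ℕ} (A : Set (Fin n → ℂ)) (hA : NullMeasurableSet A volume) (g : L2C n) :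
    projE A hA g =ᵐ[volume] A.indicator g :=
  (memLp_indicator hA g).coeFn_toLp

/-- The subspace of all `g ∈ L²(ℂⁿ)` for which the range of `W(g)` is contained in `B`. -/
def weylRangeIn {n : ℕ} (B : Submodule ℂ (L2R n)) : Submodule ℂ (L2C n) where
  carrier := {g | (weylTransformL2 g).range ≤ B}
  add_mem' := by
    rintro g₁ g₂ h₁ h₂ _ ⟨φ, rfl⟩
    simpa using B.add_mem (h₁ ⟨φ, rfl⟩) (h₂ ⟨φ, rfl⟩)
  zero_mem' := by
    rintro _ ⟨φ, rfl⟩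
    simp
  smul_mem' := by
    rintro c g h _ ⟨φ, rfl⟩
    simpa using B.smul_mem c (h ⟨φ, rfl⟩)

theorem isClosed_weylRangeIn {n : ℕ} {B : Submodule ℂ (L2R n)}
    (hB : IsClosed (B : Set (L2R n))) : IsClosed (weylRangeIn B : Set (L2C n)) := by
  have : (weylRangeIn B : Set (L2C n)) = ⋂ φ : L2R n, {g | weylTransformL2 g φ ∈ B} := by
    ext g
    simp only [Set.mem_iInter, Set.mem_ofPred_eq]
    constructor
    · intro h φ
      exact h ⟨φ, rfl⟩
    · rintro h _ ⟨φ, rfl⟩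
      exact h φ
  rw [this]
  exact isClosed_iInter fun φ => hB.preimage (by fun_prop)

instance completeSpace_weylRangeIn {n : ℕ} (B : Submodule ℂ (L2R n)) [FiniteDimensional ℂ B] :
    CompleteSpace (weylRangeIn B) :=
  (isClosed_weylRangeIn B.closed_of_finiteDimensional).completeSpace_coe

/-- The orthogonal projection `F_B` of `L²(ℂⁿ)` onto the closed subspace
`{g : the range of W(g) is contained in B}`, where `B` is a finite-dimensional subspace of
`L²(ℝⁿ)`; it satisfies `W(F_B g) = P_B W(g)`, see `weylTransformL2_projF`. -/
def projF {n : ℕ} (B : Submodule ℂ (L2R n)) [FiniteDimensional ℂ B] : L2C n →L[ℂ] L2C n :=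
  (weylRangeIn B).starProjection

/-- Matrix coefficients formed with orthogonal vectors are orthogonal. -/
theorem inner_matrixCoeffCLM_eq_zero {n : ℕ} {χ ψ : L2R n} (h : inner ℂ χ ψ = 0) (η φ : L2R n) :
    inner ℂ (matrixCoeffCLM η χ) (matrixCoeffCLM φ ψ) = 0 := by
  have nrm : ∀ φ ψ : L2R n, ‖matrixCoeffCLM φ ψ‖ = Real.sqrt ((2 * Real.pi) ^ n) * ‖φ‖ * ‖ψ‖ :=
    norm_toLp_matrixCoeff
  have diag : ∀ φ : L2R n, inner ℂ (matrixCoeffCLM φ χ) (matrixCoeffCLM φ ψ) = 0 := by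
    intro φ
    have key : ∀ c : ℂ, ‖c‖ = 1 →
        RCLike.re (inner ℂ (matrixCoeffCLM φ χ) (c • matrixCoeffCLM φ ψ)) = 0 := by
      intro c hc
      have e1 := norm_add_sq (𝕜 := ℂ) (matrixCoeffCLM φ χ) (c • matrixCoeffCLM φ ψ)
      have e2 := norm_add_sq (𝕜 := ℂ) χ (c • ψ)
      rw [inner_smul_right, h, mul_zero, map_zero, mul_zero, add_zero, norm_smul, hc, one_mul]
        at e2
      rw [← map_smul, ← map_add, nrm, nrm, nrm, norm_smul, hc, one_mul] at e1
      rw [← map_smul]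
      have e3 := congrArg (fun t => (Real.sqrt ((2 * Real.pi) ^ n) * ‖φ‖) ^ 2 * t) e2
      beta_reduce at e3
      linarith
    have k1 := key 1 (by simp)
    have k2 := key Complex.I (by simp)
    rw [one_smul] at k1
    rw [inner_smul_right] at k2
    apply Complex.ext
    · simpa using k1
    · simpa using k2
  have p1 := diag (φ + η)
  have p2 := diag (φ + Complex.I • η)
  rw [matrixCoeffCLM_add] at p1 p2
  rw [matrixCoeffCLM_smul] at p2
  simp only [_root_.add_apply, _root_.smul_apply, inner_add_left, inner_add_right,
    inner_smul_left, inner_smul_right, diag, map_neg, neg_neg, Complex.conj_I] at p1 p2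
  have hI : Complex.I ≠ 0 := Complex.I_ne_zero
  have : 2 * Complex.I * inner ℂ (matrixCoeffCLM η χ) (matrixCoeffCLM φ ψ) = 0 := by
    linear_combination Complex.I * p1 + p2
  simpa [hI] using this

/-- The relation `W(F_B g) = P_B W(g)`, where `P_B` is the orthogonal projection of `L²(ℝⁿ)`
onto `B`. -/
theorem weylTransformL2_projF {n : ℕ} (B : Submodule ℂ (L2R n)) [FiniteDimensional ℂ B]
    (g : L2C n) : weylTransformL2 (projF B g) = B.starProjection ∘L weylTransformL2 g := by
  have hK : weylTransformL2 (projF B g) = B.starProjection ∘L weylTransformL2 (projF B g) := by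
    ext1 φ
    have hmem : projF B g ∈ weylRangeIn B := Submodule.starProjection_apply_mem _ g
    exact (Submodule.starProjection_eq_self_iff.2 (hmem ⟨φ, rfl⟩)).symm
  have hperp : B.starProjection ∘L weylTransformL2 (g - projF B g) = 0 := by
    ext1 φ
    refine (Submodule.starProjection_apply_eq_zero_iff B).2 ?_
    intro ψ hψ
    rw [ContinuousLinearMap.coe_coe, weylTransformL2_apply, ContinuousLinearMap.adjoint_inner_right]
    refine Submodule.inner_right_of_mem_orthogonal (K := weylRangeIn B) ?_
      (Submodule.sub_starProjection_mem_orthogonal g)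
    rintro _ ⟨η, rfl⟩
    rw [← Submodule.orthogonal_orthogonal B]
    intro χ hχ
    rw [ContinuousLinearMap.coe_coe, weylTransformL2_apply, ContinuousLinearMap.adjoint_inner_right]
    exact inner_matrixCoeffCLM_eq_zero (Submodule.inner_left_of_mem_orthogonal hψ hχ) η φ
  rw [hK]
  rw [map_sub, ContinuousLinearMap.comp_sub, sub_eq_zero] at hperp
  exact hperp.symm

/-- For orthogonal projections `E` and `F` of a Hilbert space, the orthogonal projection `E ∩ F`
onto the intersection of their ranges. (The ranges of orthogonal projections are closed, so that
the closure taken here changes nothing.) -/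
def projInter {H : Type*} [NormedAddCommGroup H] [InnerProductSpace ℂ H] [CompleteSpace H]
    (E F : H →L[ℂ] H) : H →L[ℂ] H :=
  (E.range ⊓ F.range).topologicalClosure.starProjection

end

end HeisenbergWeyl

/-!
If `W(g)` has finite rank, Weyl inversion expresses `g(z)` as `(2π)⁻ⁿ tr (W(g) π(-z))`. Point
evaluations on `ran F_B` are therefore inner products with vectors of norm at most some `C`, and
Bessel's inequality, integrated over `A`, gives `dim (ran E_A ∩ ran F_B) ≤ C² m(A)`. The space
`ran F_B` is invariant under twisted translations, which move supports by ordinary translations. As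
in the argument of Amrein and Berthier, a nonzero `g` in it whose support has finite measure has
translates whose supports add only an arbitrarily small, but nonzero, amount of measure; `N` of
them, each adding at most `1 / N`, contradict the dimension bound when `N` is large. A dilation
reduces general `λ ≠ 0` to `λ = 1`.
-/

namespace HeisenbergWeyl

open scoped ENNReal Topology

section EvaluationKernel

variable {α 𝕜 : Type*} [MeasurableSpace α] {μ : Measure α} [RCLike 𝕜]

/-- The subspace of those `g ∈ L²(μ)` which vanish almost everywhere outside `A`. -/
def supportedIn (𝕜 : Type*) [RCLike 𝕜] (μ : Measure α) (A : Set α) : Submodule 𝕜 (Lp 𝕜 2 μ) where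
  carrier := {g | ∀ᵐ z ∂μ, z ∉ A → g z = 0}
  add_mem' {g₁ g₂} h₁ h₂ := by
    filter_upwards [h₁, h₂, Lp.coeFn_add g₁ g₂] with z e₁ e₂ e₃ hz
    rw [e₃, Pi.add_apply, e₁ hz, e₂ hz, add_zero]
  zero_mem' := by
    filter_upwards [Lp.coeFn_zero 𝕜 2 μ] with z hz _
    exact hz
  smul_mem' c g h := by
    filter_upwards [h, Lp.coeFn_smul c g] with z e₁ e₂ hz
    rw [e₂, Pi.smul_apply, e₁ hz, smul_zero]

theorem mem_supportedIn {A : Set α} {g : Lp 𝕜 2 μ} :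
    g ∈ supportedIn 𝕜 μ A ↔ ∀ᵐ z ∂μ, z ∉ A → g z = 0 := Iff.rfl

theorem supportedIn_mono {A A' : Set α} (h : A ⊆ A') : supportedIn 𝕜 μ A ≤ supportedIn 𝕜 μ A' :=
  fun _ hg => (mem_supportedIn.1 hg).mono fun _ hz hz' => hz fun hA => hz' (h hA)

/-- `k z` represents the evaluation of the elements of `M` at almost every point `z`: a reproducing
kernel for `M`, except that `k z` need not belong to `M`. -/
def IsEvaluationKernel (M : Submodule 𝕜 (Lp 𝕜 2 μ)) (k : α → Lp 𝕜 2 μ) : Prop :=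
  ∀ g ∈ M, ∀ᵐ z ∂μ, g z = inner 𝕜 (k z) g

theorem lintegral_enorm_sq_eq_enorm_sq (g : Lp 𝕜 2 μ) : ∫⁻ z, ‖g z‖ₑ ^ 2 ∂μ = ‖g‖ₑ ^ 2 := by
  rw [Lp.enorm_def, eLpNorm_eq_lintegral_rpow_enorm_toReal two_ne_zero ENNReal.ofNat_ne_top,
    ← ENNReal.rpow_natCast, ← ENNReal.rpow_mul]
  simp

theorem sum_enorm_inner_sq_le {ι E : Type*} [Fintype ι] [SeminormedAddCommGroup E]
    [InnerProductSpace 𝕜 E] {b : ι → E} (hb : Orthonormal 𝕜 b) (x : E) :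
    ∑ i, ‖inner 𝕜 x (b i)‖ₑ ^ 2 ≤ ‖x‖ₑ ^ 2 := by
  have bessel : ∑ i, ‖inner 𝕜 x (b i)‖ ^ 2 ≤ ‖x‖ ^ 2 := by
    simpa only [norm_inner_symm x] using hb.sum_inner_products_le x (s := Finset.univ)
  have hofReal : ∀ r : ℝ, 0 ≤ r → ENNReal.ofReal r ^ 2 = ENNReal.ofReal (r ^ 2) :=
    fun r hr => (ENNReal.ofReal_pow hr 2).symm
  simp only [← ofReal_norm, hofReal _ (norm_nonneg _)]
  rw [← ENNReal.ofReal_sum_of_nonneg fun i _ => by positivity]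
  exact ENNReal.ofReal_le_ofReal bessel

theorem IsEvaluationKernel.sum_enorm_sq_le {M : Submodule 𝕜 (Lp 𝕜 2 μ)} {k : α → Lp 𝕜 2 μ}
    (hk : IsEvaluationKernel M k) {C : ℝ≥0∞} (hC : ∀ z, ‖k z‖ₑ ≤ C) {A : Set α} {ι : Type*}
    [Fintype ι] {b : ι → Lp 𝕜 2 μ} (hb : Orthonormal 𝕜 b) (hbM : ∀ i, b i ∈ M ⊓ supportedIn 𝕜 μ A) :
    ∀ᵐ z ∂μ, ∑ i, ‖b i z‖ₑ ^ 2 ≤ A.indicator (fun _ => C ^ 2) z := by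
  have heval : ∀ᵐ z ∂μ, ∀ i, b i z = inner 𝕜 (k z) (b i) :=
    ae_all_iff.2 fun i => hk _ (hbM i).1
  have hsupp : ∀ᵐ z ∂μ, ∀ i, z ∉ A → b i z = 0 := ae_all_iff.2 fun i => (hbM i).2
  filter_upwards [heval, hsupp] with z hz hz'
  by_cases hzA : z ∈ A
  · rw [Set.indicator_of_mem hzA]
    simp only [hz]
    exact (sum_enorm_inner_sq_le hb (k z)).trans (pow_le_pow_left' (hC z) 2)
  · simp [hz' _ hzA]

theorem IsEvaluationKernel.finrank_le {M : Submodule 𝕜 (Lp 𝕜 2 μ)} {k : α → Lp 𝕜 2 μ}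
    (hk : IsEvaluationKernel M k) {C : ℝ≥0∞} (hC : ∀ z, ‖k z‖ₑ ≤ C) {A : Set α}
    {S : Submodule 𝕜 (Lp 𝕜 2 μ)} [FiniteDimensional 𝕜 S] (hS : S ≤ M ⊓ supportedIn 𝕜 μ A) :
    (Module.finrank 𝕜 S : ℝ≥0∞) ≤ C ^ 2 * μ A := by
  set b : Fin (Module.finrank 𝕜 S) → Lp 𝕜 2 μ := fun i => stdOrthonormalBasis 𝕜 S i
  have hon : Orthonormal 𝕜 b :=
    (stdOrthonormalBasis 𝕜 S).orthonormal.comp_linearIsometry S.subtypeₗᵢ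
  have hnorm : ∀ i, ‖b i‖ₑ = 1 := fun i => by rw [← ofReal_norm, hon.1 i, ENNReal.ofReal_one]
  calc (Module.finrank 𝕜 S : ℝ≥0∞)
      = ∑ i, ∫⁻ z, ‖b i z‖ₑ ^ 2 ∂μ := by simp [lintegral_enorm_sq_eq_enorm_sq, hnorm]
    _ = ∫⁻ z, ∑ i, ‖b i z‖ₑ ^ 2 ∂μ :=
        (lintegral_finsetSum _ fun i _ =>
          (Lp.stronglyMeasurable (b i)).measurable.enorm.pow_const 2).symm
    _ ≤ ∫⁻ z, A.indicator (fun _ => C ^ 2) z ∂μ :=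
        lintegral_mono_ae (hk.sum_enorm_sq_le hC hon fun i => hS (Subtype.prop _))
    _ ≤ C ^ 2 * μ A := lintegral_indicator_const_le A _

end EvaluationKernel

section Translates

variable {G : Type*} [AddCommGroup G] [TopologicalSpace G] [IsTopologicalAddGroup G]
  [LocallyCompactSpace G] [MeasurableSpace G] [BorelSpace G] {μ : Measure G} [μ.IsAddHaarMeasure]

theorem continuous_measure_translate_sdiff [μ.InnerRegularCompactLTTop] {A₀ : Set G}
    (hA₀ : MeasurableSet A₀) (hfin : μ A₀ ≠ ⊤) (A : Set G) :
    Continuous fun w => μ ((· + w) ⁻¹' A₀ \ A) := by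
  have hF : Continuous fun w : G => ContinuousMap.addRight w :=
    ContinuousMap.continuous_of_continuous_uncurry _ (continuous_snd.add continuous_fst)
  refine continuous_iff_continuousAt.2 fun w₀ => ?_
  have hsymm : Filter.Tendsto (fun w => μ (symmDiff ((· + w) ⁻¹' A₀) ((· + w₀) ⁻¹' A₀)))
      (𝓝 w₀) (𝓝 0) :=
    tendsto_measure_symmDiff_preimage_nhds_zero (μ := μ) (ν := μ)
      (f := fun w => ContinuousMap.addRight w) (g := ContinuousMap.addRight w₀) (hF.tendsto w₀)
      (Filter.Eventually.of_forall fun w => measurePreserving_add_right μ w)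
      (measurePreserving_add_right μ w₀) hA₀.nullMeasurableSet hfin
  have hw₀ : μ ((· + w₀) ⁻¹' A₀ \ A) ≠ ⊤ :=
    measure_ne_top_of_subset Set.sdiff_subset (by rwa [measure_preimage_add_right])
  have hle : ∀ s t : Set G, μ (s \ A) ≤ μ (t \ A) + μ (symmDiff s t) := fun s t =>
    (measure_mono fun z hz => by
      by_cases hzt : z ∈ t
      · exact Or.inl ⟨hzt, hz.2⟩
      · exact Or.inr (Or.inl ⟨hz.1, hzt⟩)).trans (measure_union_le _ _)
  refine tendsto_of_tendsto_of_tendsto_of_le_of_le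
    (by simpa using ENNReal.Tendsto.sub tendsto_const_nhds hsymm (Or.inl hw₀))
    (by simpa using tendsto_const_nhds.add hsymm)
    (fun w => tsub_le_iff_right.2 ?_) (fun w => hle _ _)
  rw [symmDiff_comm]
  exact hle _ _

theorem exists_measure_translate_sdiff_ne_zero [SecondCountableTopology G] [NoncompactSpace G]
    {A₀ A : Set G} (hA₀ : MeasurableSet A₀) (hA : MeasurableSet A) (h₀ : μ A₀ ≠ 0)
    (hfin : μ A ≠ ⊤) : ∃ w, μ ((· + w) ⁻¹' A₀ \ A) ≠ 0 := by
  by_contra! h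
  have hwz : ∀ᵐ w ∂μ, ∀ᵐ z ∂μ, z + w ∈ A₀ → z ∈ A := ae_of_all _ fun w => by
    simpa [measure_eq_zero_iff_ae_notMem] using h w
  have hzw : ∀ᵐ z ∂μ, ∀ᵐ w ∂μ, z + w ∈ A₀ → z ∈ A := by
    refine (Measure.ae_ae_comm ?_).1 hwz
    exact (((measurable_snd.add measurable_fst) hA₀).compl.union (measurable_snd hA)).congr
      (by ext; simp [imp_iff_not_or])
  have hAae : ∀ᵐ z ∂μ, z ∈ A := hzw.mono fun z hz => by
    by_contra hzA
    refine h₀ ?_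
    rw [← measure_preimage_add μ z A₀, measure_eq_zero_iff_ae_notMem]
    exact hz.mono fun w hw hw' => hzA (hw hw')
  exact hfin ((measure_congr (Filter.eventuallyEq_univ.2 hAae)).trans
    (measure_univ_of_isAddLeftInvariant μ))

theorem exists_measure_translate_sdiff_le [μ.InnerRegularCompactLTTop] [SecondCountableTopology G]
    [NoncompactSpace G] [PreconnectedSpace G] {A₀ A : Set G} (hA₀ : MeasurableSet A₀)
    (hA : MeasurableSet A) (hsub : A₀ ⊆ A) (h₀ : μ A₀ ≠ 0) (hfin : μ A ≠ ⊤) {ε : ℝ≥0∞}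
    (hε : ε ≠ 0) : ∃ w, μ ((· + w) ⁻¹' A₀ \ A) ≠ 0 ∧ μ ((· + w) ⁻¹' A₀ \ A) ≤ ε := by
  obtain ⟨w₁, hw₁⟩ := exists_measure_translate_sdiff_ne_zero hA₀ hA h₀ hfin
  obtain ⟨w, hw⟩ := mem_range_of_exists_le_of_exists_ge
    (continuous_measure_translate_sdiff hA₀ (measure_ne_top_of_subset hsub hfin) A)
    (c := min ε (μ ((· + w₁) ⁻¹' A₀ \ A)))
    ⟨0, by simp [Set.sdiff_eq_empty.2 hsub]⟩ ⟨w₁, min_le_right _ _⟩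
  have hw' : μ ((· + w) ⁻¹' A₀ \ A) = min ε (μ ((· + w₁) ⁻¹' A₀ \ A)) := hw
  rw [← pos_iff_ne_zero] at hε hw₁
  exact ⟨w, hw' ▸ (lt_min hε hw₁).ne', hw' ▸ min_le_left _ _⟩

end Translates

section AmreinBerthier

variable {G 𝕜 : Type*} [AddCommGroup G] [MeasurableSpace G] {μ : Measure G} [RCLike 𝕜]

/-- `M` contains, with every `g`, some unimodular multiple of every translate of `g`. -/
def IsTranslationInvariantUpToPhase (M : Submodule 𝕜 (Lp 𝕜 2 μ)) : Prop :=
  ∀ g ∈ M, ∀ w, ∃ g' ∈ M, ∀ᵐ z ∂μ, ‖g' z‖ = ‖g (z + w)‖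

theorem mem_supportedIn_iff_measure_translate_sdiff {g g' : Lp 𝕜 2 μ} {w : G}
    (h : ∀ᵐ z ∂μ, ‖g' z‖ = ‖g (z + w)‖) (A : Set G) :
    g' ∈ supportedIn 𝕜 μ A ↔ μ ((· + w) ⁻¹' {z | g z ≠ 0} \ A) = 0 := by
  rw [mem_supportedIn, measure_eq_zero_iff_ae_notMem]
  refine Filter.eventually_congr (h.mono fun z hz => ?_)
  rw [← norm_eq_zero, hz, norm_eq_zero]
  simp only [Set.mem_sdiff, Set.mem_preimage, Set.mem_ofPred_eq]
  tauto

variable [TopologicalSpace G] [IsTopologicalAddGroup G] [LocallyCompactSpace G]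
  [SecondCountableTopology G] [PreconnectedSpace G] [NoncompactSpace G] [BorelSpace G]
  [μ.IsAddHaarMeasure] [μ.InnerRegularCompactLTTop]

theorem IsTranslationInvariantUpToPhase.exists_finrank_lt {M : Submodule 𝕜 (Lp 𝕜 2 μ)}
    (hM : IsTranslationInvariantUpToPhase M) {g : Lp 𝕜 2 μ} (hg : g ∈ M) (hg0 : g ≠ 0) {A : Set G}
    (hA : MeasurableSet A) (hgA : {z | g z ≠ 0} ⊆ A) (hfin : μ A ≠ ⊤) {ε : ℝ≥0∞} (hε : ε ≠ 0)
    {S : Submodule 𝕜 (Lp 𝕜 2 μ)} [FiniteDimensional 𝕜 S] (hS : S ≤ M ⊓ supportedIn 𝕜 μ A) :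
    ∃ A', MeasurableSet A' ∧ A ⊆ A' ∧ μ A' ≤ μ A + ε ∧
      ∃ S' : Submodule 𝕜 (Lp 𝕜 2 μ), FiniteDimensional 𝕜 S' ∧ S' ≤ M ⊓ supportedIn 𝕜 μ A' ∧
        Module.finrank 𝕜 S < Module.finrank 𝕜 S' := by
  have hmeas : MeasurableSet {z | g z ≠ 0} :=
    (Lp.stronglyMeasurable g).measurable (measurableSet_singleton 0).compl
  have hne : μ {z | g z ≠ 0} ≠ 0 := fun h => hg0 (Lp.eq_zero_iff_ae_eq_zero.2 h)
  obtain ⟨w, hw0, hw⟩ := exists_measure_translate_sdiff_le hmeas hA hgA hne hfin hε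
  obtain ⟨g', hg'M, hg'⟩ := hM g hg w
  have hg'A : g' ∉ supportedIn 𝕜 μ A :=
    (mem_supportedIn_iff_measure_translate_sdiff hg' A).not.2 hw0
  set A' := A ∪ (· + w) ⁻¹' {z | g z ≠ 0} with hA'
  have hg'A' : g' ∈ supportedIn 𝕜 μ A' := by
    rw [mem_supportedIn_iff_measure_translate_sdiff hg',
      Set.sdiff_eq_empty.2 Set.subset_union_right, measure_empty]
  refine ⟨A', hA.union (measurable_add_const w hmeas), Set.subset_union_left, ?_,
    S ⊔ 𝕜 ∙ g', inferInstance, sup_le ?_ ?_, Submodule.finrank_lt_finrank_of_lt ?_⟩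
  · rw [hA', ← Set.union_sdiff_self]
    exact (measure_union_le _ _).trans (add_le_add_right hw _)
  · exact hS.trans (inf_le_inf_left _ (supportedIn_mono Set.subset_union_left))
  · exact (Submodule.span_singleton_le_iff_mem _ _).2 ⟨hg'M, hg'A'⟩
  · refine left_lt_sup.2 fun hle => hg'A (hS (hle ?_)).2
    exact Submodule.mem_span_singleton_self g'

theorem IsTranslationInvariantUpToPhase.exists_le_finrank {M : Submodule 𝕜 (Lp 𝕜 2 μ)}
    (hM : IsTranslationInvariantUpToPhase M) {g : Lp 𝕜 2 μ} (hg : g ∈ M) (hg0 : g ≠ 0)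
    (hfin : μ {z | g z ≠ 0} ≠ ⊤) {ε : ℝ≥0∞} (hε : ε ≠ 0) (hε' : ε ≠ ⊤) (N : ℕ) :
    ∃ A, MeasurableSet A ∧ {z | g z ≠ 0} ⊆ A ∧ μ A ≤ μ {z | g z ≠ 0} + N * ε ∧
      ∃ S : Submodule 𝕜 (Lp 𝕜 2 μ), FiniteDimensional 𝕜 S ∧ S ≤ M ⊓ supportedIn 𝕜 μ A ∧
        N ≤ Module.finrank 𝕜 S := by
  induction N with
  | zero =>
    have hmeas : MeasurableSet {z | g z ≠ 0} :=
      (Lp.stronglyMeasurable g).measurable (measurableSet_singleton 0).compl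
    exact ⟨_, hmeas, subset_rfl, by simp, ⊥, inferInstance, bot_le, by simp⟩
  | succ N ih =>
    obtain ⟨A, hA, hgA, hvol, S, hSfin, hS, hN⟩ := ih
    have hAfin : μ A ≠ ⊤ := ne_top_of_le_ne_top (by finiteness) hvol
    obtain ⟨A', hA', hAA', hvol', S', hS'fin, hS', hlt⟩ :=
      hM.exists_finrank_lt hg hg0 hA hgA hAfin hε hS
    refine ⟨A', hA', hgA.trans hAA', ?_, S', hS'fin, hS', hN.trans_lt hlt⟩
    calc μ A' ≤ μ {z | g z ≠ 0} + N * ε + ε := hvol'.trans (add_le_add_left hvol ε)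
      _ = μ {z | g z ≠ 0} + (N + 1 : ℕ) * ε := by push_cast; ring

theorem IsTranslationInvariantUpToPhase.eq_zero_of_mem_supportedIn {M : Submodule 𝕜 (Lp 𝕜 2 μ)}
    (hM : IsTranslationInvariantUpToPhase M) {k : G → Lp 𝕜 2 μ} (hk : IsEvaluationKernel M k)
    {C : ℝ≥0∞} (hC : ∀ z, ‖k z‖ₑ ≤ C) (hCtop : C ≠ ⊤) {A : Set G} (hA : μ A ≠ ⊤) {g : Lp 𝕜 2 μ}
    (hg : g ∈ M) (hgA : g ∈ supportedIn 𝕜 μ A) : g = 0 := by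
  by_contra hg0
  have hfin : μ {z | g z ≠ 0} ≠ ⊤ :=
    ne_top_of_le_ne_top hA (measure_mono_ae <|
      (mem_supportedIn.1 hgA).mono fun z hz => not_imp_comm.1 hz)
  obtain ⟨N, hN⟩ := ENNReal.exists_nat_gt
    (r := C ^ 2 * (μ {z | g z ≠ 0} + 1)) (by finiteness)
  have hN0 : (N : ℝ≥0∞) ≠ 0 := (bot_le.trans_lt hN).ne'
  obtain ⟨A', -, -, hvol, S, hSfin, hS, hNS⟩ := hM.exists_le_finrank hg hg0 hfin
    (ε := (N : ℝ≥0∞)⁻¹) (ENNReal.inv_ne_zero.2 (by finiteness)) (ENNReal.inv_ne_top.2 hN0) N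
  refine hN.not_ge ?_
  calc (N : ℝ≥0∞) ≤ Module.finrank 𝕜 S := by exact_mod_cast hNS
    _ ≤ C ^ 2 * μ A' := hk.finrank_le hC hS
    _ ≤ C ^ 2 * (μ {z | g z ≠ 0} + 1) := by
      rw [ENNReal.mul_inv_cancel hN0 (by finiteness)] at hvol
      gcongr

end AmreinBerthier

section FourierUniqueness

open BoundedContinuousFunction

variable {V W : Type*} [AddCommGroup V] [Module ℝ V] [PseudoEMetricSpace V] [MeasurableSpace V]
  [BorelSpace V] {μ : Measure V}
  [AddCommGroup W] [Module ℝ W] [TopologicalSpace W] {e : AddChar ℝ Circle}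
  {L : V →ₗ[ℝ] W →ₗ[ℝ] ℝ}

theorem integrable_char_mul (he : Continuous e) (hL : Continuous fun p : V × W => L p.1 p.2)
    {f : V → ℂ} (hf : Integrable f μ) (w : W) : Integrable (fun v => char he hL w v * f v) μ :=
  hf.bdd_mul (char he hL w).continuous.aestronglyMeasurable
    (ae_of_all _ (char he hL w).norm_coe_le_norm)

variable [CompleteSpace V] [SecondCountableTopology V]

theorem ae_eq_zero_of_integral_char_mul_ofReal_eq_zero (he : Continuous e) (he' : e ≠ 1)
    (hL' : ∀ v ≠ 0, L v ≠ 0) (hL : Continuous fun p : V × W => L p.1 p.2) {f : V → ℝ}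
    (hf : Integrable f μ) (h : ∀ w, ∫ v, char he hL w v * f v ∂μ = 0) : f =ᵐ[μ] 0 := by
  have hpos : AEMeasurable (fun v => ENNReal.ofReal (f v)) μ := hf.aemeasurable.ennreal_ofReal
  have hneg : AEMeasurable (fun v => ENNReal.ofReal (-f v)) μ := hf.neg.aemeasurable.ennreal_ofReal
  have hneg' : Integrable (fun v => -f v) μ := hf.neg
  have := isFiniteMeasure_withDensity_ofReal hf.2
  have := isFiniteMeasure_withDensity_ofReal hneg'.2
  have heq : μ.withDensity (fun v => ENNReal.ofReal (f v))
      = μ.withDensity fun v => ENNReal.ofReal (-f v) := by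
    refine ext_of_integral_char_eq he he' hL' hL fun w => ?_
    have hint : ∀ g : V → ℝ, Integrable g μ →
        Integrable (fun v => char he hL w v * ((max (g v) 0 : ℝ) : ℂ)) μ :=
      fun g hg => integrable_char_mul he hL hg.pos_part.ofReal w
    rw [integral_withDensity_eq_integral_toReal_smul₀ hpos (by simp),
      integral_withDensity_eq_integral_toReal_smul₀ hneg (by simp), ← sub_eq_zero]
    simp only [ENNReal.toReal_ofReal', Complex.real_smul, mul_comm _ (char he hL w _)]
    rw [← integral_sub (hint f hf) (hint _ hneg'), ← h w]
    simp only [← mul_sub, ← Complex.ofReal_sub, max_zero_sub_max_neg_zero_eq_self]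
  rw [withDensity_eq_iff hpos hneg hf.lintegral_lt_top.ne] at heq
  filter_upwards [heq] with v hv
  have := congrArg ENNReal.toReal hv
  rw [ENNReal.toReal_ofReal', ENNReal.toReal_ofReal'] at this
  simpa [this] using (max_zero_sub_max_neg_zero_eq_self (f v)).symm

theorem ae_eq_zero_of_integral_char_mul_eq_zero (he : Continuous e) (he' : e ≠ 1)
    (hL' : ∀ v ≠ 0, L v ≠ 0) (hL : Continuous fun p : V × W => L p.1 p.2) {f : V → ℂ}
    (hf : Integrable f μ) (h : ∀ w, ∫ v, char he hL w v * f v ∂μ = 0) : f =ᵐ[μ] 0 := by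
  have hre : ∀ g : V → ℂ, Integrable g μ → (∀ w, ∫ v, char he hL w v * g v ∂μ = 0) →
      (fun v => (g v).re) =ᵐ[μ] 0 := by
    intro g hg hg0
    refine ae_eq_zero_of_integral_char_mul_ofReal_eq_zero he he' hL' hL hg.re fun w => ?_
    have hgconj : Integrable (fun v => starRingEnd ℂ (g v)) μ :=
      (Complex.conjLIE.integrable_comp_iff).2 hg
    have hconj : ∫ v, char he hL w v * starRingEnd ℂ (g v) ∂μ = 0 := by
      rw [← map_zero (starRingEnd ℂ), ← hg0 (-w), ← integral_conj]
      simp [char_neg]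
    have hsum : ∀ v, char he hL w v * ((g v).re : ℂ)
        = (char he hL w v * g v + char he hL w v * starRingEnd ℂ (g v)) / 2 := fun v => by
      rw [Complex.re_eq_add_conj]; ring
    simp only [hsum]
    rw [integral_div, integral_add (integrable_char_mul he hL hg w)
      (integrable_char_mul he hL hgconj w), hg0, hconj, add_zero, zero_div]
  have him := hre (fun v => Complex.I * f v) (hf.const_mul _) fun w => by
    simp only [mul_left_comm _ Complex.I, integral_const_mul, h, mul_zero]
  filter_upwards [hre f hf h, him] with v hv hv'
  exact Complex.ext hv (by simpa using hv')

end FourierUniqueness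

section Schrodinger

variable {n : ℕ}

theorem rePart_add (z w : Fin n → ℂ) : rePart (z + w) = rePart z + rePart w := rfl

theorem imPart_add (z w : Fin n → ℂ) : imPart (z + w) = imPart z + imPart w := rfl

theorem rePart_smul (c : ℝ) (z : Fin n → ℂ) : rePart (c • z) = c • rePart z := by
  ext j; simp [rePart]

theorem imPart_smul (c : ℝ) (z : Fin n → ℂ) : imPart (c • z) = c • imPart z := by
  ext j; simp [imPart]

theorem rePart_I_smul (z : Fin n → ℂ) : rePart (Complex.I • z) = -imPart z := by
  ext j; simp [rePart, imPart]

theorem imPart_I_smul (z : Fin n → ℂ) : imPart (Complex.I • z) = rePart z := by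
  ext j; simp [rePart, imPart]

theorem rePart_eq_zero_and_imPart_eq_zero {z : Fin n → ℂ} :
    rePart z = 0 ∧ imPart z = 0 ↔ z = 0 := by
  simp [rePart, imPart, funext_iff, Complex.ext_iff, forall_and]

variable (n) in
/-- The symplectic form `u · y - x · v` of `z = x + i y` and `w = u + i v`. -/
noncomputable def symplecticForm : (Fin n → ℂ) →ₗ[ℝ] (Fin n → ℂ) →ₗ[ℝ] ℝ :=
  LinearMap.mk₂ ℝ (fun z w => inner ℝ (rePart w) (imPart z) - inner ℝ (rePart z) (imPart w))
    (fun z z' w => by simp only [rePart_add, imPart_add, inner_add_left, inner_add_right]; ring)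
    (fun c z w => by
      simp only [rePart_smul, imPart_smul, inner_smul_left, inner_smul_right, smul_eq_mul, mul_sub,
        conj_trivial])
    (fun z w w' => by simp only [rePart_add, imPart_add, inner_add_left, inner_add_right]; ring)
    (fun c z w => by
      simp only [rePart_smul, imPart_smul, inner_smul_left, inner_smul_right, smul_eq_mul, mul_sub,
        conj_trivial])

theorem symplecticForm_apply (z w : Fin n → ℂ) :
    symplecticForm n z w = inner ℝ (rePart w) (imPart z) - inner ℝ (rePart z) (imPart w) := rfl

theorem symplecticForm_swap (z w : Fin n → ℂ) : symplecticForm n w z = -symplecticForm n z w := by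
  simp only [symplecticForm_apply, neg_sub]

theorem symplecticForm_ne_zero {z : Fin n → ℂ} (hz : z ≠ 0) : symplecticForm n z ≠ 0 := by
  intro h
  have hzIz : symplecticForm n z (Complex.I • z) = -(‖imPart z‖ ^ 2 + ‖rePart z‖ ^ 2) := by
    rw [symplecticForm_apply, rePart_I_smul, imPart_I_smul, inner_neg_left,
      real_inner_self_eq_norm_sq, real_inner_self_eq_norm_sq, neg_add']
  rw [h, LinearMap.zero_apply, eq_comm, neg_eq_zero,
    add_eq_zero_iff_of_nonneg (sq_nonneg _) (sq_nonneg _)] at hzIz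
  exact hz (rePart_eq_zero_and_imPart_eq_zero.1 (by simpa using hzIz.symm))

theorem continuous_symplecticForm :
    Continuous fun p : (Fin n → ℂ) × (Fin n → ℂ) => symplecticForm n p.1 p.2 := by
  have hre := continuous_rePart (n := n)
  have him := continuous_imPart (n := n)
  simp only [symplecticForm_apply]
  fun_prop

theorem ae_eq_zero_of_integral_exp_symplecticForm_mul_eq_zero {f : (Fin n → ℂ) → ℂ}
    (hf : Integrable f)
    (h : ∀ w, ∫ z, Complex.exp ((symplecticForm n z w : ℂ) * Complex.I) * f z = 0) :
    f =ᵐ[volume] 0 :=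
  ae_eq_zero_of_integral_char_mul_eq_zero Real.continuous_probChar Real.probChar_ne_one
    (fun _ => symplecticForm_ne_zero) continuous_symplecticForm hf h

theorem schrodinger_schrodinger (lam : ℝ) (z w : Fin n → ℂ) (φ : L2R n) :
    schrodinger lam z (schrodinger lam w φ)
      = Complex.exp ((lam * symplecticForm n z w / 2 : ℝ) * Complex.I) •
        schrodinger lam (z + w) φ := by
  ext1
  have hw := (measurePreserving_add_right volume (imPart z)).quasiMeasurePreserving.ae
    (coeFn_schrodinger lam w φ)
  filter_upwards [coeFn_schrodinger lam z (schrodinger lam w φ), hw,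
    coeFn_schrodinger lam (z + w) φ,
    Lp.coeFn_smul (Complex.exp ((lam * symplecticForm n z w / 2 : ℝ) * Complex.I))
      (schrodinger lam (z + w) φ)]
    with ξ h₁ h₂ h₃ h₄
  rw [h₁, h₄, Pi.smul_apply, h₃, h₂, smul_eq_mul, ← mul_assoc, ← mul_assoc, ← Complex.exp_add,
    ← Complex.exp_add, imPart_add, add_assoc, rePart_add, symplecticForm_apply]
  congr 2
  simp only [inner_add_left, inner_add_right]
  push_cast
  ring

theorem schrodinger_zero (lam : ℝ) (φ : L2R n) : schrodinger lam 0 φ = φ := by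
  obtain ⟨hre, him⟩ := rePart_eq_zero_and_imPart_eq_zero.2 (rfl : (0 : Fin n → ℂ) = 0)
  ext1
  filter_upwards [coeFn_schrodinger lam 0 φ] with ξ h
  simp [h, hre, him]

theorem schrodinger_schrodinger_neg (lam : ℝ) (z : Fin n → ℂ) (φ : L2R n) :
    schrodinger lam z (schrodinger lam (-z) φ) = φ := by
  have hz : symplecticForm n z z = 0 := by rw [symplecticForm_apply, sub_self]
  rw [schrodinger_schrodinger, add_neg_cancel, schrodinger_zero, map_neg, hz]
  simp

theorem inner_schrodinger_left (lam : ℝ) (z : Fin n → ℂ) (φ ψ : L2R n) :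
    inner ℂ (schrodinger lam z φ) ψ = inner ℂ φ (schrodinger lam (-z) ψ) := by
  rw [← LinearIsometry.inner_map_map (schrodinger lam z) φ, schrodinger_schrodinger_neg]

theorem schrodinger_comm (lam : ℝ) (z w : Fin n → ℂ) (φ : L2R n) :
    schrodinger lam z (schrodinger lam w φ)
      = Complex.exp ((lam * symplecticForm n z w : ℝ) * Complex.I) •
        schrodinger lam w (schrodinger lam z φ) := by
  rw [schrodinger_schrodinger, schrodinger_schrodinger, smul_smul, add_comm w z,
    ← Complex.exp_add, symplecticForm_swap z w]
  congr 2
  push_cast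
  ring

theorem inner_schrodinger_conj (lam : ℝ) (z w : Fin n → ℂ) (φ ψ : L2R n) :
    inner ℂ (schrodinger lam w ψ) (schrodinger lam z (schrodinger lam w φ))
      = Complex.exp ((lam * symplecticForm n z w : ℝ) * Complex.I) *
        inner ℂ ψ (schrodinger lam z φ) := by
  rw [schrodinger_comm, inner_smul_right, LinearIsometry.inner_map_map]

end Schrodinger

section WeylSymbol

variable {n : ℕ} {lam : ℝ}

/-- `f` is a symbol of the operator `T`: `T = ∫ f(z) π_λ(z) dz` in the weak sense, all the defining
integrals being absolutely convergent. -/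
def IsWeylSymbol (lam : ℝ) (f : (Fin n → ℂ) → ℂ) (T : L2R n →L[ℂ] L2R n) : Prop :=
  ∀ φ ψ : L2R n, Integrable (fun z => f z * inner ℂ ψ (schrodinger lam z φ)) ∧
    ∫ z, f z * inner ℂ ψ (schrodinger lam z φ) = inner ℂ ψ (T φ)

theorem isWeylSymbol_weylTransform (lam : ℝ) (g : L1C n) :
    IsWeylSymbol lam g (weylTransform lam g) := by
  intro φ ψ
  have hint := integrable_smul_schrodinger lam g φ
  refine ⟨by simpa only [inner_smul_right] using hint.const_inner (𝕜 := ℂ) ψ, ?_⟩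
  rw [weylTransform_apply, ← integral_inner hint]
  simp only [inner_smul_right]

theorem isWeylSymbol_weylTransformL2 (g : L2C n) : IsWeylSymbol 1 g (weylTransformL2 g) :=
  fun φ ψ => ⟨(inner_weylTransformL2 g φ ψ).1, (inner_weylTransformL2 g φ ψ).2.symm⟩

theorem IsWeylSymbol.sub {f₁ f₂ : (Fin n → ℂ) → ℂ} {T₁ T₂ : L2R n →L[ℂ] L2R n}
    (h₁ : IsWeylSymbol lam f₁ T₁) (h₂ : IsWeylSymbol lam f₂ T₂) :
    IsWeylSymbol lam (f₁ - f₂) (T₁ - T₂) := by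
  intro φ ψ
  simp only [Pi.sub_apply, sub_mul, _root_.sub_apply, inner_sub_right]
  exact ⟨(h₁ φ ψ).1.sub (h₂ φ ψ).1,
    by rw [integral_sub (h₁ φ ψ).1 (h₂ φ ψ).1, (h₁ φ ψ).2, (h₂ φ ψ).2]⟩

instance nontrivial_L2R (n : ℕ) : Nontrivial (L2R n) := by
  refine ⟨indicatorConstLp 2 (measurableSet_ball (x := (0 : EuclideanSpace ℝ (Fin n)))
    (ε := 1)) measure_ball_lt_top.ne (1 : ℂ), 0, ?_⟩
  have hball : 0 < volume.real (Metric.ball (0 : EuclideanSpace ℝ (Fin n)) 1) :=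
    ENNReal.toReal_pos (Metric.measure_ball_pos _ _ one_pos).ne' measure_ball_lt_top.ne
  rw [← norm_ne_zero_iff, norm_indicatorConstLp two_ne_zero ENNReal.ofNat_ne_top]
  simpa using hball.ne'

/-- Conjugating with `π_λ(w)` multiplies `⟪ψ, π_λ(z) φ⟫` by the character
`exp (i λ symplecticForm n z w)`, so that Fourier uniqueness applies to the products
`f(z) ⟪ψ, π_λ(z) φ⟫`. -/
theorem IsWeylSymbol.mul_inner_ae_eq_zero (hlam : lam ≠ 0) {f : (Fin n → ℂ) → ℂ}
    (hf : IsWeylSymbol lam f 0) (φ ψ : L2R n) :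
    (fun z => f z * inner ℂ ψ (schrodinger lam z φ)) =ᵐ[volume] 0 := by
  refine ae_eq_zero_of_integral_exp_symplecticForm_mul_eq_zero (hf φ ψ).1 fun w => ?_
  have hw := (hf (schrodinger lam (lam⁻¹ • w) φ) (schrodinger lam (lam⁻¹ • w) ψ)).2
  simp only [inner_schrodinger_conj, map_smul, smul_eq_mul, mul_inv_cancel_left₀ hlam,
    _root_.zero_apply, inner_zero_right] at hw
  simpa only [mul_left_comm] using hw

theorem IsWeylSymbol.ae_eq_zero_of_zero (hlam : lam ≠ 0) {f : (Fin n → ℂ) → ℂ}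
    (hf : IsWeylSymbol lam f 0) : f =ᵐ[volume] 0 := by
  obtain ⟨φ, hφ⟩ := exists_ne (0 : L2R n)
  refine measure_null_of_locally_null _ fun z₀ _ => ?_
  have hcont : Continuous fun z => inner ℂ (schrodinger lam z₀ φ) (schrodinger lam z φ) :=
    continuous_const.inner (continuous_schrodinger lam φ)
  have hne : ∀ᶠ z in 𝓝 z₀, inner ℂ (schrodinger lam z₀ φ) (schrodinger lam z φ) ≠ 0 := by
    refine hcont.continuousAt.eventually_ne ?_
    rw [LinearIsometry.inner_map_map]
    exact inner_self_ne_zero.2 hφ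
  refine ⟨_, inter_mem_nhdsWithin _ hne,
    measure_mono_null ?_ (hf.mul_inner_ae_eq_zero hlam φ (schrodinger lam z₀ φ))⟩
  rintro z ⟨hfz, hz⟩ hprod
  exact hfz ((mul_eq_zero.1 hprod).resolve_right hz)

theorem IsWeylSymbol.ae_eq (hlam : lam ≠ 0) {f₁ f₂ : (Fin n → ℂ) → ℂ} {T : L2R n →L[ℂ] L2R n}
    (h₁ : IsWeylSymbol lam f₁ T) (h₂ : IsWeylSymbol lam f₂ T) : f₁ =ᵐ[volume] f₂ := by
  have hsub : f₁ - f₂ =ᵐ[volume] 0 := (sub_self T ▸ h₁.sub h₂).ae_eq_zero_of_zero hlam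
  exact hsub.mono fun z hz => sub_eq_zero.1 hz

end WeylSymbol

section WeylInversion

variable {n : ℕ}

theorem norm_matrixCoeffCLM (φ ψ : L2R n) :
    ‖matrixCoeffCLM φ ψ‖ = Real.sqrt ((2 * Real.pi) ^ n) * ‖φ‖ * ‖ψ‖ :=
  norm_toLp_matrixCoeff φ ψ

theorem inner_matrixCoeffCLM_self (φ ψ χ : L2R n) :
    inner ℂ (matrixCoeffCLM φ ψ) (matrixCoeffCLM φ χ)
      = ((2 * Real.pi) ^ n : ℝ) * (inner ℂ φ φ * inner ℂ ψ χ) := by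
  have hnorm : ∀ ψ : L2R n, (‖matrixCoeffCLM φ ψ‖ : ℂ) ^ 2
      = ((2 * Real.pi) ^ n : ℝ) * (‖φ‖ : ℂ) ^ 2 * (‖ψ‖ : ℂ) ^ 2 := fun ψ => by
    rw [norm_matrixCoeffCLM]
    norm_cast
    rw [mul_pow, mul_pow, Real.sq_sqrt (by positivity)]
  rw [inner_self_eq_norm_sq_to_K, inner_eq_sum_norm_sq_div_four (matrixCoeffCLM φ ψ),
    inner_eq_sum_norm_sq_div_four ψ]
  simp only [← map_smul, ← map_add, ← map_sub, Complex.coe_algebraMap, hnorm]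
  ring

theorem inner_matrixCoeffCLM (φ η ψ χ : L2R n) :
    inner ℂ (matrixCoeffCLM φ ψ) (matrixCoeffCLM η χ)
      = ((2 * Real.pi) ^ n : ℝ) * (inner ℂ η φ * inner ℂ ψ χ) := by
  have hadd := inner_matrixCoeffCLM_self (φ + η) ψ χ
  have hadd_I := inner_matrixCoeffCLM_self (φ + Complex.I • η) ψ χ
  simp only [matrixCoeffCLM_add, matrixCoeffCLM_smul, _root_.add_apply, _root_.smul_apply,
    inner_add_left, inner_add_right, inner_smul_left, inner_smul_right, inner_matrixCoeffCLM_self,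
    map_neg, neg_neg, Complex.conj_I] at hadd hadd_I
  refine mul_left_cancel₀ (mul_ne_zero Complex.I_ne_zero two_ne_zero) ?_
  linear_combination Complex.I * hadd - hadd_I

variable (B : Submodule ℂ (L2R n)) [FiniteDimensional ℂ B]

/-- The inverse Weyl transform `(2π)⁻ⁿ tr (T π(-z))` of an operator `T` with range in `B`, the trace
being computed in an orthonormal basis of `B`. -/
noncomputable def weylSymbol (T : L2R n →L[ℂ] L2R n) (z : Fin n → ℂ) : ℂ :=
  (((2 * Real.pi) ^ n : ℝ) : ℂ)⁻¹ * ∑ j, inner ℂ (stdOrthonormalBasis ℂ B j : L2R n)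
    (T (schrodinger 1 (-z) (stdOrthonormalBasis ℂ B j : L2R n)))

/-- The function `weylSymbol B T` as an element of `L²(ℂⁿ)`. -/
noncomputable def weylSymbolL2 (T : L2R n →L[ℂ] L2R n) : L2C n :=
  (((2 * Real.pi) ^ n : ℝ) : ℂ)⁻¹ • ∑ j, matrixCoeffCLM
    (ContinuousLinearMap.adjoint T (stdOrthonormalBasis ℂ B j : L2R n))
    (stdOrthonormalBasis ℂ B j : L2R n)

theorem coeFn_weylSymbolL2 (T : L2R n →L[ℂ] L2R n) :
    weylSymbolL2 B T =ᵐ[volume] weylSymbol B T := by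
  set c : Fin (Module.finrank ℂ B) → L2C n := fun j => matrixCoeffCLM
    (ContinuousLinearMap.adjoint T (stdOrthonormalBasis ℂ B j : L2R n))
    (stdOrthonormalBasis ℂ B j : L2R n)
  have hcoeff : ∀ᵐ z, ∀ j, c j z = inner ℂ (stdOrthonormalBasis ℂ B j : L2R n)
      (T (schrodinger 1 (-z) (stdOrthonormalBasis ℂ B j : L2R n))) :=
    ae_all_iff.2 fun j => (coeFn_matrixCoeffCLM _ _).trans <| ae_of_all _ fun z => by
      simp only [inner_schrodinger_left, ContinuousLinearMap.adjoint_inner_left]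
  filter_upwards [hcoeff, Lp.coeFn_smul (((2 * Real.pi) ^ n : ℝ) : ℂ)⁻¹ (∑ j, c j),
    Lp.coeFn_finsetSum Finset.univ c] with z hz hsmul hsum
  rw [weylSymbolL2, hsmul, Pi.smul_apply, hsum, Finset.sum_apply,
    Finset.sum_congr rfl fun j _ => hz j, smul_eq_mul, weylSymbol]

theorem weylTransformL2_weylSymbolL2 {T : L2R n →L[ℂ] L2R n} (hT : T.range ≤ B) :
    weylTransformL2 (weylSymbolL2 B T) = T := by
  have hc : (((2 * Real.pi) ^ n : ℝ) : ℂ) ≠ 0 := by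
    exact_mod_cast (by positivity : (0 : ℝ) < (2 * Real.pi) ^ n).ne'
  ext1 φ
  refine ext_inner_left ℂ fun ψ => ?_
  have hexpand : T φ = ∑ j, inner ℂ (stdOrthonormalBasis ℂ B j : L2R n) (T φ) •
      (stdOrthonormalBasis ℂ B j : L2R n) := by
    simpa using congrArg Subtype.val
      ((stdOrthonormalBasis ℂ B).sum_repr' ⟨T φ, hT ⟨φ, rfl⟩⟩).symm
  rw [weylTransformL2_apply, ContinuousLinearMap.adjoint_inner_right, weylSymbolL2,
    inner_smul_right, inner_sum]
  simp only [inner_matrixCoeffCLM, ContinuousLinearMap.adjoint_inner_left]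
  rw [← Finset.mul_sum, inv_mul_cancel_left₀ hc]
  conv_rhs => rw [hexpand]
  simp only [inner_sum, inner_smul_right]

theorem isWeylSymbol_weylSymbolL2 {T : L2R n →L[ℂ] L2R n} (hT : T.range ≤ B) :
    IsWeylSymbol 1 (weylSymbolL2 B T) T := by
  simpa only [weylTransformL2_weylSymbolL2 B hT] using
    isWeylSymbol_weylTransformL2 (weylSymbolL2 B T)

theorem weylSymbolL2_mem_weylRangeIn {T : L2R n →L[ℂ] L2R n} (hT : T.range ≤ B) :
    weylSymbolL2 B T ∈ weylRangeIn B := by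
  change (weylTransformL2 _).range ≤ B
  rwa [weylTransformL2_weylSymbolL2 B hT]

variable {B} in
theorem ae_eq_weylSymbol_of_mem_weylRangeIn {g : L2C n} (hg : g ∈ weylRangeIn B) :
    g =ᵐ[volume] weylSymbol B (weylTransformL2 g) :=
  ((isWeylSymbol_weylTransformL2 g).ae_eq one_ne_zero (isWeylSymbol_weylSymbolL2 B hg)).trans
    (coeFn_weylSymbolL2 B _)

/-- The element of `L²(ℂⁿ)` representing the functional `g ↦ weylSymbol B (W(g)) z`. -/
noncomputable def weylKernel (z : Fin n → ℂ) : L2C n :=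
  (((2 * Real.pi) ^ n : ℝ) : ℂ)⁻¹ • ∑ j, matrixCoeffCLM
    (schrodinger 1 (-z) (stdOrthonormalBasis ℂ B j : L2R n)) (stdOrthonormalBasis ℂ B j : L2R n)

theorem inner_weylKernel (z : Fin n → ℂ) (g : L2C n) :
    inner ℂ (weylKernel B z) g = weylSymbol B (weylTransformL2 g) z := by
  simp only [weylKernel, weylSymbol, inner_smul_left, sum_inner, map_inv₀, Complex.conj_ofReal,
    weylTransformL2_apply, ContinuousLinearMap.adjoint_inner_right]

theorem norm_weylKernel_le (z : Fin n → ℂ) :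
    ‖weylKernel B z‖ ≤ ((2 * Real.pi) ^ n)⁻¹ *
      (Module.finrank ℂ B * Real.sqrt ((2 * Real.pi) ^ n)) := by
  have hb : ∀ j, ‖(stdOrthonormalBasis ℂ B j : L2R n)‖ = 1 :=
    (stdOrthonormalBasis ℂ B).orthonormal.1
  rw [weylKernel, norm_smul, norm_inv, Complex.norm_real, Real.norm_of_nonneg (by positivity)]
  gcongr
  refine (norm_sum_le _ _).trans_eq ?_
  simp [norm_matrixCoeffCLM, hb]

theorem isEvaluationKernel_weylKernel : IsEvaluationKernel (weylRangeIn B) (weylKernel B) :=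
  fun g hg => (ae_eq_weylSymbol_of_mem_weylRangeIn hg).mono fun z hz => by
    rw [hz, inner_weylKernel]

theorem norm_weylSymbol_comp_schrodinger (T : L2R n →L[ℂ] L2R n) (w z : Fin n → ℂ) :
    ‖weylSymbol B (T ∘L (schrodinger 1 (-w)).toContinuousLinearMap) z‖
      = ‖weylSymbol B T (z + w)‖ := by
  simp only [weylSymbol, ContinuousLinearMap.comp_apply, LinearIsometry.coe_toContinuousLinearMap,
    schrodinger_schrodinger, map_smul, inner_smul_right, ← Finset.mul_sum, norm_mul,
    Complex.norm_exp_ofReal_mul_I, one_mul, neg_add_rev]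

theorem isTranslationInvariantUpToPhase_weylRangeIn :
    IsTranslationInvariantUpToPhase (weylRangeIn B) := by
  intro g hg w
  have hT : (weylTransformL2 g ∘L (schrodinger 1 (-w)).toContinuousLinearMap).range ≤ B :=
    (LinearMap.range_comp_le_range _ _).trans hg
  refine ⟨_, weylSymbolL2_mem_weylRangeIn B hT, ?_⟩
  filter_upwards [coeFn_weylSymbolL2 B _,
    (measurePreserving_add_right volume w).quasiMeasurePreserving.ae
      (ae_eq_weylSymbol_of_mem_weylRangeIn hg)] with z hz hzw
  rw [hz, hzw, norm_weylSymbol_comp_schrodinger]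

variable {B}

theorem eq_zero_of_mem_weylRangeIn_of_mem_supportedIn [NeZero n] {A : Set (Fin n → ℂ)}
    (hA : volume A ≠ ⊤) {g : L2C n} (hg : g ∈ weylRangeIn B)
    (hgA : g ∈ supportedIn ℂ volume A) : g = 0 := by
  have hbound : ∀ z, ‖weylKernel B z‖ₑ ≤ ENNReal.ofReal (((2 * Real.pi) ^ n)⁻¹ *
      (Module.finrank ℂ B * Real.sqrt ((2 * Real.pi) ^ n))) := fun z => by
    rw [← ofReal_norm]
    exact ENNReal.ofReal_le_ofReal (norm_weylKernel_le B z)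
  exact (isTranslationInvariantUpToPhase_weylRangeIn B).eq_zero_of_mem_supportedIn
    (isEvaluationKernel_weylKernel B) hbound ENNReal.ofReal_ne_top hA hg hgA

end WeylInversion

section Dilation

variable {n : ℕ} {lam : ℝ}

/-- The dilation `x + i y ↦ a x + i y`. -/
noncomputable def dilateRe (a : ℝ) : (Fin n → ℂ) →ₗ[ℝ] (Fin n → ℂ) where
  toFun z := fun j => ⟨a * (z j).re, (z j).im⟩
  map_add' z w := by
    funext j
    apply Complex.ext <;> simp [mul_add]
  map_smul' c z := by
    funext j
    apply Complex.ext <;> simp [mul_left_comm]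

theorem rePart_dilateRe (a : ℝ) (z : Fin n → ℂ) : rePart (dilateRe a z) = a • rePart z := rfl

theorem imPart_dilateRe (a : ℝ) (z : Fin n → ℂ) : imPart (dilateRe a z) = imPart z := rfl

theorem dilateRe_inv_dilateRe {a : ℝ} (ha : a ≠ 0) (z : Fin n → ℂ) :
    dilateRe a⁻¹ (dilateRe a z) = z := by
  funext j
  apply Complex.ext <;> simp [dilateRe, ha]

theorem det_dilateRe_ne_zero {a : ℝ} (ha : a ≠ 0) : LinearMap.det (dilateRe (n := n) a) ≠ 0 := by
  have hinv : dilateRe (n := n) a⁻¹ ∘ₗ dilateRe a = LinearMap.id :=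
    LinearMap.ext (dilateRe_inv_dilateRe ha)
  refine right_ne_zero_of_mul (a := LinearMap.det (dilateRe (n := n) a⁻¹)) ?_
  rw [← LinearMap.det_comp, hinv, LinearMap.det_id]
  exact one_ne_zero

theorem schrodinger_dilateRe (lam a : ℝ) (z : Fin n → ℂ) (φ : L2R n) :
    schrodinger lam (dilateRe a z) φ = schrodinger (lam * a) z φ := by
  ext1
  filter_upwards [coeFn_schrodinger lam (dilateRe a z) φ, coeFn_schrodinger (lam * a) z φ]
    with ξ h₁ h₂
  rw [h₁, h₂, rePart_dilateRe, imPart_dilateRe, inner_smul_left, inner_smul_left]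
  congr 3
  simp only [conj_trivial]
  push_cast
  ring

theorem IsWeylSymbol.comp_dilateRe {f : (Fin n → ℂ) → ℂ} {T : L2R n →L[ℂ] L2R n}
    (h : IsWeylSymbol lam f T) {a : ℝ} (ha : a ≠ 0) :
    IsWeylSymbol (lam * a) (f ∘ dilateRe a) (|(LinearMap.det (dilateRe (n := n) a))⁻¹| • T) := by
  intro φ ψ
  have hmeas : Measurable (dilateRe (n := n) a) :=
    (dilateRe a).continuous_of_finiteDimensional.measurable
  have hmap := Measure.map_linearMap_addHaar_eq_smul_addHaar
    (volume : Measure (Fin n → ℂ)) (det_dilateRe_ne_zero ha)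
  obtain ⟨hint, heq⟩ := h φ ψ
  have hint' := hint.smul_measure
    (ENNReal.ofReal_ne_top (r := |(LinearMap.det (dilateRe (n := n) a))⁻¹|))
  rw [← hmap] at hint'
  simp only [Function.comp_apply, ← schrodinger_dilateRe]
  refine ⟨hint'.comp_measurable hmeas, ?_⟩
  rw [← integral_map hmeas.aemeasurable hint'.1, hmap, integral_smul_measure, heq,
    ENNReal.toReal_ofReal (abs_nonneg _), _root_.smul_apply, inner_smul_right_eq_smul]

theorem quasiMeasurePreserving_dilateRe {a : ℝ} (ha : a ≠ 0) :
    Measure.QuasiMeasurePreserving (dilateRe (n := n) a) := by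
  refine ⟨(dilateRe a).continuous_of_finiteDimensional.measurable, ?_⟩
  rw [Measure.map_linearMap_addHaar_eq_smul_addHaar _ (det_dilateRe_ne_zero ha)]
  exact Measure.smul_absolutelyContinuous

end Dilation

section FiniteRank

variable {n : ℕ} [NeZero n] {lam : ℝ} {A : Set (Fin n → ℂ)} {f : (Fin n → ℂ) → ℂ}
  {T : L2R n →L[ℂ] L2R n}

theorem IsWeylSymbol.ae_eq_zero_of_finiteDimensional_range_one (hf : IsWeylSymbol 1 f T)
    (hT : FiniteDimensional ℂ T.range) (hA : volume A ≠ ⊤) (hfA : ∀ᵐ z, z ∉ A → f z = 0) :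
    f =ᵐ[volume] 0 := by
  have hfg : f =ᵐ[volume] weylSymbolL2 T.range T :=
    hf.ae_eq one_ne_zero (isWeylSymbol_weylSymbolL2 _ le_rfl)
  have hg : weylSymbolL2 T.range T = 0 := by
    refine eq_zero_of_mem_weylRangeIn_of_mem_supportedIn hA
      (weylSymbolL2_mem_weylRangeIn _ le_rfl) ?_
    filter_upwards [hfg, hfA] with z hz hzA
    rwa [← hz]
  exact hfg.trans (Lp.eq_zero_iff_ae_eq_zero.1 hg)

theorem IsWeylSymbol.ae_eq_zero_of_finiteDimensional_range (hlam : lam ≠ 0)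
    (hf : IsWeylSymbol lam f T) (hT : FiniteDimensional ℂ T.range) (hA : volume A ≠ ⊤)
    (hfA : ∀ᵐ z, z ∉ A → f z = 0) : f =ᵐ[volume] 0 := by
  have hlam' := inv_ne_zero hlam
  have hg := hf.comp_dilateRe hlam'
  rw [mul_inv_cancel₀ hlam] at hg
  have hrange : FiniteDimensional ℂ
      (|(LinearMap.det (dilateRe (n := n) lam⁻¹))⁻¹| • T).range := by
    refine Submodule.finiteDimensional_of_le (S₂ := T.range) ?_
    rintro _ ⟨φ, rfl⟩
    exact T.range.smul_of_tower_mem |(LinearMap.det (dilateRe (n := n) lam⁻¹))⁻¹| ⟨φ, rfl⟩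
  have hvol : volume (dilateRe lam⁻¹ ⁻¹' A) ≠ ⊤ := by
    rw [Measure.addHaar_preimage_linearMap _ (det_dilateRe_ne_zero hlam')]
    finiteness
  have hg0 := hg.ae_eq_zero_of_finiteDimensional_range_one hrange hvol
    ((quasiMeasurePreserving_dilateRe hlam').ae hfA)
  refine ((quasiMeasurePreserving_dilateRe hlam).ae hg0).mono fun z hz => ?_
  rwa [Function.comp_apply, dilateRe_inv_dilateRe hlam] at hz

end FiniteRank

theorem projInter_eq_zero {H : Type*} [NormedAddCommGroup H] [InnerProductSpace ℂ H]
    [CompleteSpace H] {E F : H →L[ℂ] H} (h : E.range ⊓ F.range = ⊥) : projInter E F = 0 := by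
  have hclosure : (E.range ⊓ F.range).topologicalClosure = ⊥ := by
    rw [h, (Submodule.closed_of_finiteDimensional ⊥).submodule_topologicalClosure_eq]
  ext1 x
  have hx : projInter E F x ∈ (E.range ⊓ F.range).topologicalClosure :=
    Submodule.starProjection_apply_mem _ x
  rwa [hclosure] at hx

theorem range_projE_le {n : ℕ} {A : Set (Fin n → ℂ)} (hA : NullMeasurableSet A volume) :
    (projE A hA).range ≤ supportedIn ℂ volume A := by
  rintro _ ⟨g, rfl⟩
  filter_upwards [coeFn_projE A hA g] with z hz hzA
  exact hz.trans (Set.indicator_of_notMem hzA _)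

theorem range_projF_le {n : ℕ} (B : Submodule ℂ (L2R n)) [FiniteDimensional ℂ B] :
    (projF B).range ≤ weylRangeIn B := by
  rintro _ ⟨g, rfl⟩
  exact Submodule.starProjection_apply_mem _ g

end HeisenbergWeyl

open HeisenbergWeyl in
theorem proposition6p7 (n : ℕ) (hn : 1 ≤ n) (A : Set (Fin n → ℂ))
    (hA : NullMeasurableSet A (volume : Measure (Fin n → ℂ)))
    (hA_fin : (volume : Measure (Fin n → ℂ)) A < ⊤) :
    (∀ lam : ℝ, lam ≠ 0 → ∀ g : L1C n, (∀ᵐ z : Fin n → ℂ, z ∉ A → g z = 0) →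
      FiniteDimensional ℂ (weylTransform lam g).range → g = 0) ∧
    (∀ (B : Submodule ℂ (L2R n)) [FiniteDimensional ℂ B],
      projInter (projE A hA) (projF B) = 0) := by
  have : NeZero n := ⟨by omega⟩
  refine ⟨fun lam hlam g hgA hW => ?_, fun B _ => projInter_eq_zero (eq_bot_iff.2 ?_)⟩
  · exact Lp.eq_zero_iff_ae_eq_zero.2 <|
      (isWeylSymbol_weylTransform lam g).ae_eq_zero_of_finiteDimensional_range hlam hW
        hA_fin.ne hgA
  · rintro g ⟨hgE, hgF⟩
    exact eq_zero_of_mem_weylRangeIn_of_mem_supportedIn hA_fin.ne (range_projF_le B hgF)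
      (range_projE_le hA hgE)
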